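/- Let $T$ be a compact connected abelian Lie group and let $M$ be a smooth manifold with a smooth $T$-action and a $T$-equivariant stable complex structure, i.e. a smooth $T$-equivariant complex structure $J$ on the fibres of $TM\oplus\tau$, where $\tau=M\times\mathbb{R}^k$ is a product bundle with $T$ acting trivially on $\mathbb{R}^k$. Assume that the fixed point set $M^T$ has finitely many connected components. For a $T$-space $X$ let $K_T(X)$ denote the Grothendieck ring of $T$-equivariant complex vector bundles on $X$ (with sum $\oplus$ and product $\otimes$), which is an algebra over $K_T(\mathrm{pt})$ by pullback along $X\to\mathrm{pt}$, and let $\mathbb{Z}[T]$ be the integral group ring of the (abstract) group $T$. For a connected component $W$ of $M^T$ the normal bundle $\nu(W,M)=TM|_W/TW\cong (TM\oplus\tau)|_W/(TW\oplus\tau)$ is a $T$-equivariant complex vector bundle over $W$, where $T_pW\oplus\tau_p$ is the ($J$-invariant) subspace of $T$-fixed vectors of $T_pM\oplus\tau_p$. It is the direct sum of its nonzero isotypic components $I_\mu$, on which $T$ acts through continuous characters $\mu:T\to U(1)$. For a character $\mu$ and $t\in T$ let $a_\mu(t)\in[0,1)$ be the number with $\mu(t)=e^{2\pi i a_\mu(t)}$;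 then $a_\mu(t_1)+a_\mu(t_2)-a_\mu(t_1t_2)\in\{0,1\}$. For an equivariant bundle $E$ let $\epsilon(E)=\sum_{k\ge 0}(-1)^k[\Lambda^kE^*]$ be its $K$-theoretic Euler class. Then there is exactly one $\mathbb{Z}$-bilinear product $\star$ on $K_T(M^T)\otimes_{\mathbb Z}\mathbb{Z}[T]$ such that for all $\sigma_1,\sigma_2\in K_T(M^T)$, all $t_1,t_2\in T$ and every connected component $W$ of $M^T$ $$ \big((\sigma_1\otimes t_1)\star(\sigma_2\otimes t_2)\big)\big|_W=\Big[\sigma_1|_W\cdot\sigma_2|_W\cdot\prod_{I_\mu\subset\nu(W,M)}\epsilon(I_\mu)^{a_\mu(t_1)+a_\mu(t_2)-a_\mu(t_1t_2)}\Big]\otimes t_1t_2 $$ in $K_T(W)\otimes_{\mathbb Z}\mathbb{Z}[T]$, and $\star$ makes $K_T(M^T)\otimes_{\mathbb Z}\mathbb{Z}[T]$ a commutative, associative algebra over $K_T(\mathrm{pt})$ with unit $1\otimes 1$ (in particular $\star$ is $K_T(\mathrm{pt})$-bilinear). -/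

import Mathlib

open scoped TensorProduct Manifold ContDiff
namespace EquivK

noncomputable section

open Module

universe u v w

/-- A complex vector bundle over `X`, as a family of complex vector spaces with an atlas of
local frames: around each point `x₀` there is an open set `nhd x₀` over which the fibres are given
bases, and the changes of frame are continuous. The rank may vary from component to component. -/
structure VBundle (X : Type u) [TopologicalSpace X] where
  fib : X → Type
  [instAddCommGroup : ∀ x, AddCommGroup (fib x)]
  [instModule : ∀ x, Module ℂ (fib x)]
  nhd : X → Set X
  isOpen_nhd : ∀ x, IsOpen (nhd x)
  mem_nhd : ∀ x, x ∈ nhd x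
  idx : X → Type
  [instFinite : ∀ x, Finite (idx x)]
  frame : ∀ x₀ x, x ∈ nhd x₀ → Basis (idx x₀) ℂ (fib x)
  continuous_transition : ∀ x₀ x₁ j i,
    Continuous fun p : {p : X // p ∈ nhd x₀ ∧ p ∈ nhd x₁} =>
      (frame x₁ p.1 p.2.2).repr (frame x₀ p.1 p.2.1 j) i

attribute [instance] VBundle.instAddCommGroup VBundle.instModule VBundle.instFinite

/-- A family of linear maps `φ z : E_{a z} → F_{b z}` between fibres of bundles, parametrized by a
space `Z`, is continuous if its matrix entries in the local frames are continuous. -/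
def IsContFam {X : Type u} {Y : Type v} {Z : Type w} [TopologicalSpace X] [TopologicalSpace Y]
    [TopologicalSpace Z] (E : VBundle X) (F : VBundle Y) (a : Z → X) (b : Z → Y)
    (φ : ∀ z, E.fib (a z) →ₗ[ℂ] F.fib (b z)) : Prop :=
  ∀ x₀ y₁ j i, Continuous fun z : {z : Z // a z ∈ E.nhd x₀ ∧ b z ∈ F.nhd y₁} =>
    (F.frame y₁ (b z.1) z.2.2).repr (φ z.1 (E.frame x₀ (a z.1) z.2.1 j)) i

section ContFam

variable {X : Type*} {Y : Type*} {X' : Type*} {Z : Type*} {Z' : Type*} [TopologicalSpace X]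
  [TopologicalSpace Y] [TopologicalSpace X'] [TopologicalSpace Z] [TopologicalSpace Z']

theorem isContFam_id (E : VBundle X) : IsContFam E E id id (fun _ => LinearMap.id) :=
  fun x₀ x₁ j i => E.continuous_transition x₀ x₁ j i

theorem IsContFam.param {E : VBundle X} {F : VBundle Y} {a : Z → X} {b : Z → Y}
    {φ : ∀ z, E.fib (a z) →ₗ[ℂ] F.fib (b z)} (h : IsContFam E F a b φ) {g : Z' → Z}
    (hg : Continuous g) : IsContFam E F (a ∘ g) (b ∘ g) (fun z => φ (g z)) := by
  intro x₀ y₁ j i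
  exact (h x₀ y₁ j i).comp
    (f := fun z : {z : Z' // (a ∘ g) z ∈ E.nhd x₀ ∧ (b ∘ g) z ∈ F.nhd y₁} =>
      (⟨g z.1, z.2⟩ : {z : Z // a z ∈ E.nhd x₀ ∧ b z ∈ F.nhd y₁}))
    ((hg.comp continuous_subtype_val).subtype_mk _)

theorem IsContFam.comp {E : VBundle X} {F : VBundle Y} {G : VBundle X'} {a : Z → X} {b : Z → Y}
    {c : Z → X'} {φ : ∀ z, E.fib (a z) →ₗ[ℂ] F.fib (b z)}
    {ψ : ∀ z, F.fib (b z) →ₗ[ℂ] G.fib (c z)} (hψ : IsContFam F G b c ψ)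
    (hφ : IsContFam E F a b φ) (hb : Continuous b) :
    IsContFam E G a c (fun z => ψ z ∘ₗ φ z) := by
  intro x₀ y₁ j i
  refine continuous_iff_continuousAt.2 fun z₀ => ?_
  set f := fun z : {z : Z // a z ∈ E.nhd x₀ ∧ c z ∈ G.nhd y₁} =>
    (G.frame y₁ (c z.1) z.2.2).repr ((ψ z.1 ∘ₗ φ z.1) (E.frame x₀ (a z.1) z.2.1 j)) i with hf
  set O : Set {z : Z // a z ∈ E.nhd x₀ ∧ c z ∈ G.nhd y₁} := {z | b z.1 ∈ F.nhd (b z₀.1)} with hO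
  have hOo : IsOpen O := (F.isOpen_nhd _).preimage (hb.comp continuous_subtype_val)
  refine ContinuousOn.continuousAt (s := O) ?_ (hOo.mem_nhds (F.mem_nhd _))
  rw [continuousOn_iff_continuous_domRestrict]
  let _ := Fintype.ofFinite (F.idx (b z₀.1))
  have key : O.domRestrict f = fun z : O => ∑ k,
      (F.frame (b z₀.1) (b z.1.1) z.2).repr (φ z.1.1 (E.frame x₀ (a z.1.1) z.1.2.1 j)) k *
      (G.frame y₁ (c z.1.1) z.1.2.2).repr (ψ z.1.1 (F.frame (b z₀.1) (b z.1.1) z.2 k)) i := by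
    funext z
    change (G.frame y₁ (c z.1.1) z.1.2.2).repr
      (ψ z.1.1 (φ z.1.1 (E.frame x₀ (a z.1.1) z.1.2.1 j))) i = _
    conv_lhs => rw [← (F.frame (b z₀.1) (b z.1.1) z.2).sum_repr
      (φ z.1.1 (E.frame x₀ (a z.1.1) z.1.2.1 j))]
    simp only [map_sum, map_smul, Finsupp.finsetSum_apply, Finsupp.smul_apply, smul_eq_mul]
  rw [key]
  refine continuous_finsetSum _ fun k _ => Continuous.mul ?_ ?_
  · exact (hφ x₀ (b z₀.1) j k).comp
      (f := fun z : O => (⟨z.1.1, z.1.2.1, z.2⟩ :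
        {z : Z // a z ∈ E.nhd x₀ ∧ b z ∈ F.nhd (b z₀.1)}))
      ((continuous_subtype_val.comp continuous_subtype_val).subtype_mk _)
  · exact (hψ (b z₀.1) y₁ k i).comp
      (f := fun z : O => (⟨z.1.1, z.2, z.1.2.2⟩ :
        {z : Z // b z ∈ F.nhd (b z₀.1) ∧ c z ∈ G.nhd y₁}))
      ((continuous_subtype_val.comp continuous_subtype_val).subtype_mk _)

end ContFam

/-! ### Operations on vector bundles -/

namespace VBundle

variable {X : Type u} {Y : Type v} [TopologicalSpace X] [TopologicalSpace Y]

/-- The zero bundle. -/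
def zero (X : Type u) [TopologicalSpace X] : VBundle X where
  fib _ := PUnit
  nhd _ := Set.univ
  isOpen_nhd _ := isOpen_univ
  mem_nhd _ := trivial
  idx _ := Empty
  frame _ _ _ := Basis.empty _
  continuous_transition _ _ j := j.elim

/-- The product line bundle. -/
def one (X : Type u) [TopologicalSpace X] : VBundle X where
  fib _ := ℂ
  nhd _ := Set.univ
  isOpen_nhd _ := isOpen_univ
  mem_nhd _ := trivial
  idx _ := Unit
  frame _ _ _ := Basis.singleton Unit ℂ
  continuous_transition _ _ _ _ := continuous_const

theorem sum_transition (E F : VBundle X) {Z : Type*} [TopologicalSpace Z] {a b : Z → X}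
    {E' F' : VBundle X} {φ : ∀ z, E.fib (a z) →ₗ[ℂ] E'.fib (b z)}
    {ψ : ∀ z, F.fib (a z) →ₗ[ℂ] F'.fib (b z)} (hφ : IsContFam E E' a b φ)
    (hψ : IsContFam F F' a b ψ) (x₀ x₁) (j : E.idx x₀ ⊕ F.idx x₀) (i : E'.idx x₁ ⊕ F'.idx x₁) :
    Continuous fun z : {z : Z // a z ∈ E.nhd x₀ ∩ F.nhd x₀ ∧ b z ∈ E'.nhd x₁ ∩ F'.nhd x₁} =>
      ((E'.frame x₁ (b z.1) z.2.2.1).prod (F'.frame x₁ (b z.1) z.2.2.2)).repr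
        ((φ z.1).prodMap (ψ z.1)
          ((E.frame x₀ (a z.1) z.2.1.1).prod (F.frame x₀ (a z.1) z.2.1.2) j)) i := by
  rcases j with j | j <;> rcases i with i | i <;>
    simp only [Basis.prod_repr_inl, Basis.prod_repr_inr, LinearMap.prodMap_apply,
      Basis.prod_apply_inl_fst, Basis.prod_apply_inl_snd, Basis.prod_apply_inr_fst,
      Basis.prod_apply_inr_snd, map_zero, Finsupp.coe_zero, Pi.zero_apply]
  · exact (hφ x₀ x₁ j i).comp
      (f := fun z : {z : Z // a z ∈ E.nhd x₀ ∩ F.nhd x₀ ∧ b z ∈ E'.nhd x₁ ∩ F'.nhd x₁} =>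
        (⟨z.1, z.2.1.1, z.2.2.1⟩ : {z : Z // a z ∈ E.nhd x₀ ∧ b z ∈ E'.nhd x₁}))
      (continuous_subtype_val.subtype_mk _)
  · exact continuous_const
  · exact continuous_const
  · exact (hψ x₀ x₁ j i).comp
      (f := fun z : {z : Z // a z ∈ E.nhd x₀ ∩ F.nhd x₀ ∧ b z ∈ E'.nhd x₁ ∩ F'.nhd x₁} =>
        (⟨z.1, z.2.1.2, z.2.2.2⟩ : {z : Z // a z ∈ F.nhd x₀ ∧ b z ∈ F'.nhd x₁}))
      (continuous_subtype_val.subtype_mk _)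

/-- The direct sum of vector bundles. -/
def sum (E F : VBundle X) : VBundle X where
  fib x := E.fib x × F.fib x
  nhd x := E.nhd x ∩ F.nhd x
  isOpen_nhd x := (E.isOpen_nhd x).inter (F.isOpen_nhd x)
  mem_nhd x := ⟨E.mem_nhd x, F.mem_nhd x⟩
  idx x := E.idx x ⊕ F.idx x
  frame x₀ x h := (E.frame x₀ x h.1).prod (F.frame x₀ x h.2)
  continuous_transition x₀ x₁ j i := by
    simpa using sum_transition E F (isContFam_id E) (isContFam_id F) x₀ x₁ j i

theorem _root_.EquivK.IsContFam.prodMap {E F : VBundle X} {Z : Type*} [TopologicalSpace Z]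
    {a b : Z → X} {E' F' : VBundle X} {φ : ∀ z, E.fib (a z) →ₗ[ℂ] E'.fib (b z)}
    {ψ : ∀ z, F.fib (a z) →ₗ[ℂ] F'.fib (b z)} (hφ : IsContFam E E' a b φ)
    (hψ : IsContFam F F' a b ψ) :
    IsContFam (E.sum F) (E'.sum F') a b (fun z => (φ z).prodMap (ψ z)) :=
  fun x₀ x₁ j i => sum_transition E F hφ hψ x₀ x₁ j i

theorem tensor_transition (E F : VBundle X) {Z : Type*} [TopologicalSpace Z] {a b : Z → X}
    {E' F' : VBundle X} {φ : ∀ z, E.fib (a z) →ₗ[ℂ] E'.fib (b z)}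
    {ψ : ∀ z, F.fib (a z) →ₗ[ℂ] F'.fib (b z)} (hφ : IsContFam E E' a b φ)
    (hψ : IsContFam F F' a b ψ) (x₀ x₁) (j : E.idx x₀ × F.idx x₀) (i : E'.idx x₁ × F'.idx x₁) :
    Continuous fun z : {z : Z // a z ∈ E.nhd x₀ ∩ F.nhd x₀ ∧ b z ∈ E'.nhd x₁ ∩ F'.nhd x₁} =>
      ((E'.frame x₁ (b z.1) z.2.2.1).tensorProduct (F'.frame x₁ (b z.1) z.2.2.2)).repr
        (TensorProduct.map (φ z.1) (ψ z.1)
          ((E.frame x₀ (a z.1) z.2.1.1).tensorProduct (F.frame x₀ (a z.1) z.2.1.2) j)) i := by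
  obtain ⟨j, j'⟩ := j
  obtain ⟨i, i'⟩ := i
  simp only [Basis.tensorProduct_apply, TensorProduct.map_tmul,
    Basis.tensorProduct_repr_tmul_apply, smul_eq_mul]
  refine Continuous.mul ?_ ?_
  · exact (hψ x₀ x₁ j' i').comp
      (f := fun z : {z : Z // a z ∈ E.nhd x₀ ∩ F.nhd x₀ ∧ b z ∈ E'.nhd x₁ ∩ F'.nhd x₁} =>
        (⟨z.1, z.2.1.2, z.2.2.2⟩ : {z : Z // a z ∈ F.nhd x₀ ∧ b z ∈ F'.nhd x₁}))
      (continuous_subtype_val.subtype_mk _)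
  · exact (hφ x₀ x₁ j i).comp
      (f := fun z : {z : Z // a z ∈ E.nhd x₀ ∩ F.nhd x₀ ∧ b z ∈ E'.nhd x₁ ∩ F'.nhd x₁} =>
        (⟨z.1, z.2.1.1, z.2.2.1⟩ : {z : Z // a z ∈ E.nhd x₀ ∧ b z ∈ E'.nhd x₁}))
      (continuous_subtype_val.subtype_mk _)

/-- The tensor product of vector bundles. -/
def tensor (E F : VBundle X) : VBundle X where
  fib x := E.fib x ⊗[ℂ] F.fib x
  nhd x := E.nhd x ∩ F.nhd x
  isOpen_nhd x := (E.isOpen_nhd x).inter (F.isOpen_nhd x)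
  mem_nhd x := ⟨E.mem_nhd x, F.mem_nhd x⟩
  idx x := E.idx x × F.idx x
  frame x₀ x h := (E.frame x₀ x h.1).tensorProduct (F.frame x₀ x h.2)
  continuous_transition x₀ x₁ j i := by
    simpa using tensor_transition E F (isContFam_id E) (isContFam_id F) x₀ x₁ j i

theorem _root_.EquivK.IsContFam.tensorMap {E F : VBundle X} {Z : Type*} [TopologicalSpace Z]
    {a b : Z → X} {E' F' : VBundle X} {φ : ∀ z, E.fib (a z) →ₗ[ℂ] E'.fib (b z)}
    {ψ : ∀ z, F.fib (a z) →ₗ[ℂ] F'.fib (b z)} (hφ : IsContFam E E' a b φ)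
    (hψ : IsContFam F F' a b ψ) :
    IsContFam (E.tensor F) (E'.tensor F') a b (fun z => TensorProduct.map (φ z) (ψ z)) :=
  fun x₀ x₁ j i => tensor_transition E F hφ hψ x₀ x₁ j i

open Classical in
/-- The dual of a vector bundle. -/
def dual (E : VBundle X) : VBundle X where
  fib x := Module.Dual ℂ (E.fib x)
  nhd := E.nhd
  isOpen_nhd := E.isOpen_nhd
  mem_nhd := E.mem_nhd
  idx := E.idx
  frame x₀ x h := (E.frame x₀ x h).dualBasis
  continuous_transition x₀ x₁ j i := by
    simp only [Basis.dualBasis_repr, Basis.dualBasis_apply]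
    exact (E.continuous_transition x₁ x₀ i j).comp
      (f := fun p : {p : X // p ∈ E.nhd x₀ ∧ p ∈ E.nhd x₁} =>
        (⟨p.1, p.2.2, p.2.1⟩ : {p : X // p ∈ E.nhd x₁ ∧ p ∈ E.nhd x₀}))
      (continuous_subtype_val.subtype_mk _)

theorem _root_.EquivK.IsContFam.dualMap {E : VBundle X} {F : VBundle X} {Z : Type*}
    [TopologicalSpace Z] {a b : Z → X} {φ : ∀ z, E.fib (a z) →ₗ[ℂ] F.fib (b z)}
    (hφ : IsContFam E F a b φ) :
    IsContFam F.dual E.dual b a (fun z => (φ z).dualMap) := by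
  classical
  intro x₀ x₁ j i
  have h : ∀ z : {z : Z // b z ∈ F.dual.nhd x₀ ∧ a z ∈ E.dual.nhd x₁},
      (E.dual.frame x₁ (a z.1) z.2.2).repr ((φ z.1).dualMap (F.dual.frame x₀ (b z.1) z.2.1 j)) i
      = (F.frame x₀ (b z.1) z.2.1).repr (φ z.1 (E.frame x₁ (a z.1) z.2.2 i)) j := by
    intro z
    refine (Basis.dualBasis_repr (E.frame x₁ (a z.1) z.2.2) _ i).trans ?_
    exact Basis.dualBasis_apply (F.frame x₀ (b z.1) z.2.1) j _
  refine Continuous.congr ?_ fun z => (h z).symm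
  exact (hφ x₁ x₀ i j).comp
    (f := fun z : {z : Z // b z ∈ F.dual.nhd x₀ ∧ a z ∈ E.dual.nhd x₁} =>
      (⟨z.1, z.2.2, z.2.1⟩ : {z : Z // a z ∈ E.nhd x₁ ∧ b z ∈ F.nhd x₀}))
    (continuous_subtype_val.subtype_mk _)

/-- An auxiliary linear order on the index set of a frame. -/
abbrev idxOrder (E : VBundle X) (x : X) : LinearOrder (E.idx x) :=
  LinearOrder.lift' (Finite.equivFin (E.idx x)) (Finite.equivFin (E.idx x)).injective

attribute [local instance] idxOrder

theorem ext_transition (E : VBundle X) (n : ℕ) {Z : Type*} [TopologicalSpace Z] {a b : Z → X}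
    {E' : VBundle X} {φ : ∀ z, E.fib (a z) →ₗ[ℂ] E'.fib (b z)} (hφ : IsContFam E E' a b φ) (x₀ x₁)
    (j : Set.powersetCard (E.idx x₀) n) (i : Set.powersetCard (E'.idx x₁) n) :
    Continuous fun z : {z : Z // a z ∈ E.nhd x₀ ∧ b z ∈ E'.nhd x₁} =>
      ((E'.frame x₁ (b z.1) z.2.2).exteriorPower n).repr
        (exteriorPower.map n (φ z.1) ((E.frame x₀ (a z.1) z.2.1).exteriorPower n j)) i := by
  simp only [exteriorPower.basis_repr_apply, exteriorPower.basis_apply,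
    exteriorPower.map_apply_ιMulti_family]
  simp only [exteriorPower.ιMulti_family, exteriorPower.ιMultiDual_apply_ιMulti]
  refine Continuous.matrix_det ?_
  refine continuous_matrix fun k l => ?_
  exact hφ x₀ x₁ _ _

/-- The exterior powers of a vector bundle. -/
def ext (E : VBundle X) (n : ℕ) : VBundle X where
  fib x := ⋀[ℂ]^n (E.fib x)
  nhd := E.nhd
  isOpen_nhd := E.isOpen_nhd
  mem_nhd := E.mem_nhd
  idx x := Set.powersetCard (E.idx x) n
  frame x₀ x h := (E.frame x₀ x h).exteriorPower n
  continuous_transition x₀ x₁ j i := by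
    simpa using ext_transition E n (isContFam_id E) x₀ x₁ j i

theorem _root_.EquivK.IsContFam.extMap {E E' : VBundle X} (n : ℕ) {Z : Type*} [TopologicalSpace Z]
    {a b : Z → X} {φ : ∀ z, E.fib (a z) →ₗ[ℂ] E'.fib (b z)} (hφ : IsContFam E E' a b φ) :
    IsContFam (E.ext n) (E'.ext n) a b (fun z => exteriorPower.map n (φ z)) :=
  fun x₀ x₁ j i => ext_transition E n hφ x₀ x₁ j i

/-- The pullback of a vector bundle along a continuous map. -/
def pullback (E : VBundle X) (f : Y → X) (hf : Continuous f) : VBundle Y where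
  fib y := E.fib (f y)
  nhd y := f ⁻¹' E.nhd (f y)
  isOpen_nhd _ := (E.isOpen_nhd _).preimage hf
  mem_nhd _ := E.mem_nhd _
  idx y := E.idx (f y)
  frame y₀ y h := E.frame (f y₀) (f y) h
  continuous_transition y₀ y₁ j i :=
    ((isContFam_id E).param hf) (f y₀) (f y₁) j i

end VBundle

/-! ### Continuity of the structural maps -/

namespace IsContFam

variable {X : Type u} [TopologicalSpace X] {Y : Type v} [TopologicalSpace Y] {Z : Type w}
  [TopologicalSpace Z]

theorem congr {E : VBundle X} {F : VBundle Y} {a : Z → X} {b : Z → Y}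
    {φ ψ : ∀ z, E.fib (a z) →ₗ[ℂ] F.fib (b z)} (h : IsContFam E F a b φ) (e : ∀ z, φ z = ψ z) :
    IsContFam E F a b ψ := by
  obtain rfl : φ = ψ := funext e
  exact h

theorem fst (E F : VBundle X) :
    IsContFam (E.sum F) E id id (fun x => LinearMap.fst ℂ (E.fib x) (F.fib x)) := by
  intro x₀ x₁ j i
  rcases j with j | j
  · exact (E.continuous_transition x₀ x₁ j i).comp
      (f := fun z : {z : X // z ∈ E.nhd x₀ ∩ F.nhd x₀ ∧ z ∈ E.nhd x₁} =>
        (⟨z.1, z.2.1.1, z.2.2⟩ : {z : X // z ∈ E.nhd x₀ ∧ z ∈ E.nhd x₁}))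
      (continuous_subtype_val.subtype_mk _) |>.congr fun z => by
        change _ = (E.frame x₁ z.1 z.2.2).repr
          (((E.frame x₀ z.1 z.2.1.1).prod (F.frame x₀ z.1 z.2.1.2) (Sum.inl j)).1) i
        rw [Basis.prod_apply_inl_fst]
        rfl
  · refine (continuous_const (y := (0 : ℂ))).congr fun z => ?_
    change _ = (E.frame x₁ z.1 z.2.2).repr
      (((E.frame x₀ z.1 z.2.1.1).prod (F.frame x₀ z.1 z.2.1.2) (Sum.inr j)).1) i
    rw [Basis.prod_apply_inr_fst]
    simp

theorem snd (E F : VBundle X) :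
    IsContFam (E.sum F) F id id (fun x => LinearMap.snd ℂ (E.fib x) (F.fib x)) := by
  intro x₀ x₁ j i
  rcases j with j | j
  · refine (continuous_const (y := (0 : ℂ))).congr fun z => ?_
    change _ = (F.frame x₁ z.1 z.2.2).repr
      (((E.frame x₀ z.1 z.2.1.1).prod (F.frame x₀ z.1 z.2.1.2) (Sum.inl j)).2) i
    rw [Basis.prod_apply_inl_snd]
    simp
  · exact (F.continuous_transition x₀ x₁ j i).comp
      (f := fun z : {z : X // z ∈ E.nhd x₀ ∩ F.nhd x₀ ∧ z ∈ F.nhd x₁} =>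
        (⟨z.1, z.2.1.2, z.2.2⟩ : {z : X // z ∈ F.nhd x₀ ∧ z ∈ F.nhd x₁}))
      (continuous_subtype_val.subtype_mk _) |>.congr fun z => by
        change _ = (F.frame x₁ z.1 z.2.2).repr
          (((E.frame x₀ z.1 z.2.1.1).prod (F.frame x₀ z.1 z.2.1.2) (Sum.inr j)).2) i
        rw [Basis.prod_apply_inr_snd]
        rfl

theorem pair {G : VBundle Y} {E F : VBundle X} {a : Z → Y} {b : Z → X}
    {φ : ∀ z, G.fib (a z) →ₗ[ℂ] E.fib (b z)} {ψ : ∀ z, G.fib (a z) →ₗ[ℂ] F.fib (b z)}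
    (hφ : IsContFam G E a b φ) (hψ : IsContFam G F a b ψ) :
    IsContFam G (E.sum F) a b (fun z => (φ z).prod (ψ z)) := by
  intro x₀ x₁ j i
  rcases i with i | i
  · exact (hφ x₀ x₁ j i).comp
      (f := fun z : {z : Z // a z ∈ G.nhd x₀ ∧ b z ∈ E.nhd x₁ ∩ F.nhd x₁} =>
        (⟨z.1, z.2.1, z.2.2.1⟩ : {z : Z // a z ∈ G.nhd x₀ ∧ b z ∈ E.nhd x₁}))
      (continuous_subtype_val.subtype_mk _)
  · exact (hψ x₀ x₁ j i).comp
      (f := fun z : {z : Z // a z ∈ G.nhd x₀ ∧ b z ∈ E.nhd x₁ ∩ F.nhd x₁} =>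
        (⟨z.1, z.2.1, z.2.2.2⟩ : {z : Z // a z ∈ G.nhd x₀ ∧ b z ∈ F.nhd x₁}))
      (continuous_subtype_val.subtype_mk _)

theorem zero (E : VBundle X) (F : VBundle Y) (a : Z → X) (b : Z → Y) :
    IsContFam E F a b (fun _ => 0) := by
  intro x₀ x₁ j i
  refine (continuous_const (y := (0 : ℂ))).congr fun z => ?_
  simp

theorem add {E : VBundle X} {F : VBundle Y} {a : Z → X} {b : Z → Y}
    {φ ψ : ∀ z, E.fib (a z) →ₗ[ℂ] F.fib (b z)} (hφ : IsContFam E F a b φ)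
    (hψ : IsContFam E F a b ψ) : IsContFam E F a b (fun z => φ z + ψ z) := by
  intro x₀ x₁ j i
  refine ((hφ x₀ x₁ j i).add (hψ x₀ x₁ j i)).congr fun z => ?_
  simp

theorem smul {E : VBundle X} {F : VBundle Y} {a : Z → X} {b : Z → Y}
    {φ : ∀ z, E.fib (a z) →ₗ[ℂ] F.fib (b z)} (c : ℂ) (hφ : IsContFam E F a b φ) :
    IsContFam E F a b (fun z => c • φ z) := by
  intro x₀ x₁ j i
  refine ((hφ x₀ x₁ j i).const_mul c).congr fun z => ?_
  simp

theorem inl (E F : VBundle X) :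
    IsContFam E (E.sum F) id id (fun x => LinearMap.inl ℂ (E.fib x) (F.fib x)) :=
  (isContFam_id E).pair (zero E F id id)

theorem inr (E F : VBundle X) :
    IsContFam F (E.sum F) id id (fun x => LinearMap.inr ℂ (E.fib x) (F.fib x)) :=
  (zero F E id id).pair (isContFam_id F)

theorem coprod {G : VBundle Y} {E F : VBundle X} {a : X → Y}
    {φ : ∀ z, E.fib z →ₗ[ℂ] G.fib (a z)} {ψ : ∀ z, F.fib z →ₗ[ℂ] G.fib (a z)}
    (hφ : IsContFam E G id a φ) (hψ : IsContFam F G id a ψ) :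
    IsContFam (E.sum F) G id a (fun z => (φ z).coprod (ψ z)) :=
  (hφ.comp (fst E F) continuous_id).add (hψ.comp (snd E F) continuous_id)

theorem tensorComm (E F : VBundle X) : IsContFam (E.tensor F) (F.tensor E) id id
    (fun x => (TensorProduct.comm ℂ (E.fib x) (F.fib x)).toLinearMap) := by
  rintro x₀ x₁ ⟨j, j'⟩ ⟨i', i⟩
  refine ((isContFam_id E).tensorMap (isContFam_id F) x₀ x₁ (j, j') (i, i')).comp
    (f := fun z : {z : X // z ∈ E.nhd x₀ ∩ F.nhd x₀ ∧ z ∈ F.nhd x₁ ∩ E.nhd x₁} =>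
      (⟨z.1, z.2.1, z.2.2.2, z.2.2.1⟩ :
        {z : X // z ∈ E.nhd x₀ ∩ F.nhd x₀ ∧ z ∈ E.nhd x₁ ∩ F.nhd x₁}))
    (continuous_subtype_val.subtype_mk _) |>.congr fun z => ?_
  change ((E.frame x₁ z.1 z.2.2.2).tensorProduct (F.frame x₁ z.1 z.2.2.1)).repr
      (TensorProduct.map LinearMap.id LinearMap.id
        ((E.frame x₀ z.1 z.2.1.1).tensorProduct (F.frame x₀ z.1 z.2.1.2) (j, j'))) (i, i') =
    ((F.frame x₁ z.1 z.2.2.1).tensorProduct (E.frame x₁ z.1 z.2.2.2)).repr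
      (TensorProduct.comm ℂ _ _
        ((E.frame x₀ z.1 z.2.1.1).tensorProduct (F.frame x₀ z.1 z.2.1.2) (j, j'))) (i', i)
  simp [mul_comm]

theorem lid (E : VBundle X) : IsContFam ((VBundle.one X).tensor E) E id id
    (fun x => (TensorProduct.lid ℂ (E.fib x)).toLinearMap) := by
  rintro x₀ x₁ ⟨k, j⟩ i
  refine (E.continuous_transition x₀ x₁ j i).comp
    (f := fun z : {z : X // z ∈ Set.univ ∩ E.nhd x₀ ∧ z ∈ E.nhd x₁} =>
      (⟨z.1, z.2.1.2, z.2.2⟩ : {z : X // z ∈ E.nhd x₀ ∧ z ∈ E.nhd x₁}))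
    (continuous_subtype_val.subtype_mk _) |>.congr fun z => ?_
  have key : ∀ k : Unit, (E.frame x₁ z.1 z.2.2).repr (E.frame x₀ z.1 z.2.1.2 j) i =
      (E.frame x₁ z.1 z.2.2).repr (TensorProduct.lid ℂ _
        ((Basis.singleton Unit ℂ).tensorProduct (E.frame x₀ z.1 z.2.1.2) (k, j))) i := by
    intro k
    rw [Basis.tensorProduct_apply, TensorProduct.lid_tmul, Basis.singleton_apply, one_smul]
  exact key k

theorem lid_symm (E : VBundle X) : IsContFam E ((VBundle.one X).tensor E) id id
    (fun x => (TensorProduct.lid ℂ (E.fib x)).symm.toLinearMap) := by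
  rintro x₀ x₁ j ⟨k, i⟩
  refine (E.continuous_transition x₀ x₁ j i).comp
    (f := fun z : {z : X // z ∈ E.nhd x₀ ∧ z ∈ Set.univ ∩ E.nhd x₁} =>
      (⟨z.1, z.2.1, z.2.2.2⟩ : {z : X // z ∈ E.nhd x₀ ∧ z ∈ E.nhd x₁}))
    (continuous_subtype_val.subtype_mk _) |>.congr fun z => ?_
  have key : ∀ k : Unit, (E.frame x₁ z.1 z.2.2.2).repr (E.frame x₀ z.1 z.2.1 j) i =
      ((Basis.singleton Unit ℂ).tensorProduct (E.frame x₁ z.1 z.2.2.2)).repr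
        ((TensorProduct.lid ℂ _).symm (E.frame x₀ z.1 z.2.1 j)) (k, i) := by
    intro k
    rw [TensorProduct.lid_symm_apply, Basis.tensorProduct_repr_tmul_apply,
      Basis.singleton_repr, smul_eq_mul, mul_one]
  exact key k

theorem assoc (E F G : VBundle X) :
    IsContFam ((E.tensor F).tensor G) (E.tensor (F.tensor G)) id id
      (fun x => (TensorProduct.assoc ℂ (E.fib x) (F.fib x) (G.fib x)).toLinearMap) := by
  rintro x₀ x₁ ⟨⟨j, k⟩, l⟩ ⟨j', k', l'⟩
  refine (((isContFam_id E).tensorMap (isContFam_id F)).tensorMap (isContFam_id G)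
    x₀ x₁ ((j, k), l) ((j', k'), l')).comp
    (f := fun z : {z : X // z ∈ (E.nhd x₀ ∩ F.nhd x₀) ∩ G.nhd x₀ ∧
        z ∈ E.nhd x₁ ∩ (F.nhd x₁ ∩ G.nhd x₁)} =>
      (⟨z.1, z.2.1, ⟨z.2.2.1, z.2.2.2.1⟩, z.2.2.2.2⟩ :
        {z : X // z ∈ (E.nhd x₀ ∩ F.nhd x₀) ∩ G.nhd x₀ ∧
          z ∈ (E.nhd x₁ ∩ F.nhd x₁) ∩ G.nhd x₁}))
    (continuous_subtype_val.subtype_mk _) |>.congr fun z => ?_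
  change (((E.frame x₁ z.1 z.2.2.1).tensorProduct (F.frame x₁ z.1 z.2.2.2.1)).tensorProduct
      (G.frame x₁ z.1 z.2.2.2.2)).repr
      (TensorProduct.map (TensorProduct.map LinearMap.id LinearMap.id) LinearMap.id
        (((E.frame x₀ z.1 z.2.1.1.1).tensorProduct (F.frame x₀ z.1 z.2.1.1.2)).tensorProduct
          (G.frame x₀ z.1 z.2.1.2) ((j, k), l))) ((j', k'), l') =
    ((E.frame x₁ z.1 z.2.2.1).tensorProduct ((F.frame x₁ z.1 z.2.2.2.1).tensorProduct
      (G.frame x₁ z.1 z.2.2.2.2))).repr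
      (TensorProduct.assoc ℂ _ _ _
        (((E.frame x₀ z.1 z.2.1.1.1).tensorProduct (F.frame x₀ z.1 z.2.1.1.2)).tensorProduct
          (G.frame x₀ z.1 z.2.1.2) ((j, k), l))) (j', k', l')
  simp [mul_assoc]

theorem assoc_symm (E F G : VBundle X) :
    IsContFam (E.tensor (F.tensor G)) ((E.tensor F).tensor G) id id
      (fun x => (TensorProduct.assoc ℂ (E.fib x) (F.fib x) (G.fib x)).symm.toLinearMap) := by
  rintro x₀ x₁ ⟨j, k, l⟩ ⟨⟨j', k'⟩, l'⟩
  refine ((isContFam_id E).tensorMap ((isContFam_id F).tensorMap (isContFam_id G))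
    x₀ x₁ (j, k, l) (j', k', l')).comp
    (f := fun z : {z : X // z ∈ E.nhd x₀ ∩ (F.nhd x₀ ∩ G.nhd x₀) ∧
        z ∈ (E.nhd x₁ ∩ F.nhd x₁) ∩ G.nhd x₁} =>
      (⟨z.1, z.2.1, z.2.2.1.1, z.2.2.1.2, z.2.2.2⟩ :
        {z : X // z ∈ E.nhd x₀ ∩ (F.nhd x₀ ∩ G.nhd x₀) ∧
          z ∈ E.nhd x₁ ∩ (F.nhd x₁ ∩ G.nhd x₁)}))
    (continuous_subtype_val.subtype_mk _) |>.congr fun z => ?_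
  change ((E.frame x₁ z.1 z.2.2.1.1).tensorProduct ((F.frame x₁ z.1 z.2.2.1.2).tensorProduct
      (G.frame x₁ z.1 z.2.2.2))).repr
      (TensorProduct.map LinearMap.id (TensorProduct.map LinearMap.id LinearMap.id)
        ((E.frame x₀ z.1 z.2.1.1).tensorProduct ((F.frame x₀ z.1 z.2.1.2.1).tensorProduct
          (G.frame x₀ z.1 z.2.1.2.2)) (j, k, l))) (j', k', l') =
    (((E.frame x₁ z.1 z.2.2.1.1).tensorProduct (F.frame x₁ z.1 z.2.2.1.2)).tensorProduct
      (G.frame x₁ z.1 z.2.2.2)).repr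
      ((TensorProduct.assoc ℂ _ _ _).symm
        ((E.frame x₀ z.1 z.2.1.1).tensorProduct ((F.frame x₀ z.1 z.2.1.2.1).tensorProduct
          (G.frame x₀ z.1 z.2.1.2.2)) (j, k, l))) ((j', k'), l')
  simp [mul_assoc]

end IsContFam

/-! ### Equivariant vector bundles -/

/-- A `T`-equivariant complex vector bundle over a `T`-space `X`: a vector bundle on whose total
space `T` acts continuously, covering the action on `X` and linearly on the fibres. The map
`act t h : E_x → E_y` is the action of `t`, where `h` witnesses that `t • x = y`. -/
structure TBundle (T : Type v) (X : Type u) [Group T] [TopologicalSpace T] [TopologicalSpace X]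
    [MulAction T X] extends VBundle X where
  act : ∀ (t : T) {x y : X}, t • x = y → (fib x →ₗ[ℂ] fib y)
  act_one : ∀ (x : X) (h : (1 : T) • x = x) (v : fib x), act 1 h v = v
  act_mul : ∀ (s t : T) (x y z : X) (h₁ : t • x = y) (h₂ : s • y = z) (h₃ : (s * t) • x = z)
    (v : fib x), act (s * t) h₃ v = act s h₂ (act t h₁ v)
  continuous_act : IsContFam toVBundle toVBundle (fun p : T × X => p.2) (fun p => p.1 • p.2)
    (fun p => act p.1 rfl)

namespace TBundle

variable {T : Type v} {X : Type u} {Y : Type w} [Group T] [TopologicalSpace T]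
  [TopologicalSpace X] [TopologicalSpace Y] [MulAction T X] [MulAction T Y]

/-- The zero bundle. -/
def zero (T : Type v) (X : Type u) [Group T] [TopologicalSpace T] [TopologicalSpace X]
    [MulAction T X] : TBundle T X where
  toVBundle := VBundle.zero X
  act _ _ _ _ := LinearMap.id (M := PUnit)
  act_one _ _ _ := rfl
  act_mul _ _ _ _ _ _ _ _ _ := rfl
  continuous_act _ _ j := Empty.elim j

/-- The product line bundle with `T` acting trivially on the fibre `ℂ`. -/
def one (T : Type v) (X : Type u) [Group T] [TopologicalSpace T] [TopologicalSpace X]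
    [MulAction T X] : TBundle T X where
  toVBundle := VBundle.one X
  act _ _ _ _ := LinearMap.id (M := ℂ)
  act_one _ _ _ := rfl
  act_mul _ _ _ _ _ _ _ _ _ := rfl
  continuous_act x₀ x₁ j i := (continuous_const : Continuous
    fun _ : {z : T × X // z.2 ∈ (VBundle.one X).nhd x₀ ∧ z.1 • z.2 ∈ (VBundle.one X).nhd x₁} =>
      (Basis.singleton Unit ℂ).repr (Basis.singleton Unit ℂ j) i)

/-- The direct sum, with the diagonal action. -/
def sum (E F : TBundle T X) : TBundle T X where
  toVBundle := E.toVBundle.sum F.toVBundle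
  act t _ _ h := (E.act t h).prodMap (F.act t h)
  act_one x h v := Prod.ext (E.act_one x h v.1) (F.act_one x h v.2)
  act_mul s t x y z h₁ h₂ h₃ v :=
    Prod.ext (E.act_mul s t x y z h₁ h₂ h₃ v.1) (F.act_mul s t x y z h₁ h₂ h₃ v.2)
  continuous_act := E.continuous_act.prodMap F.continuous_act

/-- The tensor product, with the diagonal action. -/
def tensor (E F : TBundle T X) : TBundle T X where
  toVBundle := E.toVBundle.tensor F.toVBundle
  act t _ _ h := TensorProduct.map (E.act t h) (F.act t h)
  act_one x h v := by
    have h₁ : E.act 1 h = LinearMap.id := LinearMap.ext (E.act_one x h)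
    have h₂ : F.act 1 h = LinearMap.id := LinearMap.ext (F.act_one x h)
    rw [h₁, h₂, TensorProduct.map_id]
    rfl
  act_mul s t x y z h₁ h₂ h₃ v := by
    have e₁ : E.act (s * t) h₃ = E.act s h₂ ∘ₗ E.act t h₁ :=
      LinearMap.ext (E.act_mul s t x y z h₁ h₂ h₃)
    have e₂ : F.act (s * t) h₃ = F.act s h₂ ∘ₗ F.act t h₁ :=
      LinearMap.ext (F.act_mul s t x y z h₁ h₂ h₃)
    rw [e₁, e₂, TensorProduct.map_comp]
    rfl
  continuous_act := by
    have h := E.continuous_act.tensorMap F.continuous_act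
    exact h

/-- The dual bundle, with the contragredient action `(t f)(v) = f (t⁻¹ v)`. -/
def dual [ContinuousInv T] [ContinuousSMul T X] (E : TBundle T X) : TBundle T X where
  toVBundle := E.toVBundle.dual
  act t _ _ h := (E.act t⁻¹ (inv_smul_eq_iff.2 h.symm)).dualMap
  act_one x h f := by
    change Module.Dual ℂ (E.fib x) at f
    refine LinearMap.ext fun v => congrArg (fun u => f u) ?_
    have : ∀ (s : T) (hs : s = 1) (h' : s • x = x), E.act s h' v = v := by
      rintro s rfl h'
      exact E.act_one x h' v
    exact this _ inv_one _
  act_mul s t x y z h₁ h₂ h₃ f := by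
    change Module.Dual ℂ (E.fib x) at f
    refine LinearMap.ext fun v => congrArg (fun u => f u) ?_
    have : ∀ (r : T) (hr : r = t⁻¹ * s⁻¹) (h' : r • z = x), E.act r h' v =
        E.act t⁻¹ (inv_smul_eq_iff.2 h₁.symm) (E.act s⁻¹ (inv_smul_eq_iff.2 h₂.symm) v) := by
      rintro r rfl h'
      exact E.act_mul _ _ _ _ _ _ _ _ _
    exact this _ (mul_inv_rev s t) _
  continuous_act := by
    have h := E.continuous_act.param (g := fun p : T × X => (p.1⁻¹, p.1 • p.2)) (by fun_prop)
    refine IsContFam.dualMap (a := fun p : T × X => p.1 • p.2) (b := fun p => p.2)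
      (φ := fun p => E.act p.1⁻¹ (inv_smul_smul p.1 p.2)) ?_
    have key : ∀ (b : T × X → X) (hb : ∀ p, p.1⁻¹ • p.1 • p.2 = b p),
        IsContFam E.toVBundle E.toVBundle (fun p : T × X => p.1 • p.2) b
          (fun p => E.act p.1⁻¹ (hb p)) := by
      intro b hb
      obtain rfl : b = fun p => p.1⁻¹ • p.1 • p.2 := funext fun p => (hb p).symm
      exact h
    exact key _ _

/-- The exterior powers. -/
def ext (E : TBundle T X) (n : ℕ) : TBundle T X where
  toVBundle := E.toVBundle.ext n
  act t _ _ h := exteriorPower.map n (E.act t h)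
  act_one x h v := by
    have h₁ : E.act 1 h = LinearMap.id := LinearMap.ext (E.act_one x h)
    rw [h₁, exteriorPower.map_id]
    rfl
  act_mul s t x y z h₁ h₂ h₃ v := by
    have e₁ : E.act (s * t) h₃ = E.act s h₂ ∘ₗ E.act t h₁ :=
      LinearMap.ext (E.act_mul s t x y z h₁ h₂ h₃)
    rw [e₁]
    exact LinearMap.congr_fun (exteriorPower.map_comp (n := n) (E.act t h₁) (E.act s h₂)) v
  continuous_act := E.continuous_act.extMap n

/-- The pullback along a continuous equivariant map. -/
def pullback (E : TBundle T X) (f : Y → X) (hf : Continuous f)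
    (hf' : ∀ (t : T) y, f (t • y) = t • f y) : TBundle T Y where
  toVBundle := E.toVBundle.pullback f hf
  act t _ _ h := E.act t ((hf' t _).symm.trans (congrArg f h))
  act_one _ _ v := E.act_one _ _ v
  act_mul s t _ _ _ _ _ _ v := E.act_mul s t _ _ _ _ _ _ v
  continuous_act := by
    have h := E.continuous_act.param (g := fun p : T × Y => (p.1, f p.2)) (by fun_prop)
    have key : ∀ (b : T × Y → X) (hb : ∀ p, p.1 • f p.2 = b p),
        IsContFam E.toVBundle E.toVBundle (fun p : T × Y => f p.2) b
          (fun p => E.act p.1 (hb p)) := by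
      intro b hb
      obtain rfl : b = fun p => p.1 • f p.2 := funext fun p => (hb p).symm
      exact h
    exact fun y₀ y₁ j i => key (fun p => f (p.1 • p.2)) (fun p => (hf' p.1 p.2).symm)
      (f y₀) (f y₁) j i

/-- An isomorphism of `T`-equivariant vector bundles over `X`. -/
structure Iso (E F : TBundle T X) where
  toEquiv : ∀ x, E.fib x ≃ₗ[ℂ] F.fib x
  equivariant : ∀ (t : T) (x y : X) (h : t • x = y) (v : E.fib x),
    toEquiv y (E.act t h v) = F.act t h (toEquiv x v)
  continuous_toEquiv : IsContFam E.toVBundle F.toVBundle id id (fun x => (toEquiv x).toLinearMap)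
  continuous_symm :
    IsContFam F.toVBundle E.toVBundle id id (fun x => (toEquiv x).symm.toLinearMap)

namespace Iso

variable {E F G H : TBundle T X}

def refl (E : TBundle T X) : Iso E E where
  toEquiv _ := LinearEquiv.refl _ _
  equivariant _ _ _ _ _ := rfl
  continuous_toEquiv := isContFam_id _
  continuous_symm := isContFam_id _

def symm (e : Iso E F) : Iso F E where
  toEquiv x := (e.toEquiv x).symm
  equivariant t x y h v := by
    rw [LinearEquiv.symm_apply_eq, e.equivariant, LinearEquiv.apply_symm_apply]
  continuous_toEquiv := e.continuous_symm
  continuous_symm := e.continuous_toEquiv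

def trans (e : Iso E F) (f : Iso F G) : Iso E G where
  toEquiv x := (e.toEquiv x).trans (f.toEquiv x)
  equivariant t x y h v := by simp [e.equivariant, f.equivariant]
  continuous_toEquiv := by
    have h := f.continuous_toEquiv.comp e.continuous_toEquiv continuous_id
    exact h
  continuous_symm := by
    have h := e.continuous_symm.comp f.continuous_symm continuous_id
    exact h

def sumCongr (e : Iso E F) (f : Iso G H) : Iso (E.sum G) (F.sum H) where
  toEquiv x := (e.toEquiv x).prodCongr (f.toEquiv x)
  equivariant t x y h v := Prod.ext (e.equivariant t x y h v.1) (f.equivariant t x y h v.2)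
  continuous_toEquiv := by
    have h := e.continuous_toEquiv.prodMap f.continuous_toEquiv
    exact h
  continuous_symm := by
    have h := e.continuous_symm.prodMap f.continuous_symm
    exact h

def tensorCongr (e : Iso E F) (f : Iso G H) : Iso (E.tensor G) (F.tensor H) where
  toEquiv x := TensorProduct.congr (e.toEquiv x) (f.toEquiv x)
  equivariant t x y h v := by
    have key : (TensorProduct.congr (e.toEquiv y) (f.toEquiv y)).toLinearMap ∘ₗ
        TensorProduct.map (E.act t h) (G.act t h) =
        TensorProduct.map (F.act t h) (H.act t h) ∘ₗ
          (TensorProduct.congr (e.toEquiv x) (f.toEquiv x)).toLinearMap :=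
      TensorProduct.ext' fun a b => congrArg₂ (TensorProduct.tmul ℂ) (e.equivariant t x y h a)
        (f.equivariant t x y h b)
    exact LinearMap.congr_fun key v
  continuous_toEquiv := by
    have h := e.continuous_toEquiv.tensorMap f.continuous_toEquiv
    exact h
  continuous_symm := by
    have h := e.continuous_symm.tensorMap f.continuous_symm
    exact h

def sumComm (E F : TBundle T X) : Iso (E.sum F) (F.sum E) where
  toEquiv x := LinearEquiv.prodComm ℂ (E.fib x) (F.fib x)
  equivariant _ _ _ _ _ := rfl
  continuous_toEquiv := by
    have h := (IsContFam.snd E.toVBundle F.toVBundle).pair (IsContFam.fst E.toVBundle F.toVBundle)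
    exact h
  continuous_symm := by
    have h := (IsContFam.snd F.toVBundle E.toVBundle).pair (IsContFam.fst F.toVBundle E.toVBundle)
    exact h

def sumAssoc (E F G : TBundle T X) : Iso ((E.sum F).sum G) (E.sum (F.sum G)) where
  toEquiv x := LinearEquiv.prodAssoc ℂ (E.fib x) (F.fib x) (G.fib x)
  equivariant _ _ _ _ _ := rfl
  continuous_toEquiv := by
    have h₁ := IsContFam.fst (E.toVBundle.sum F.toVBundle) G.toVBundle
    have h₂ := IsContFam.snd (E.toVBundle.sum F.toVBundle) G.toVBundle
    have h₃ := (IsContFam.fst E.toVBundle F.toVBundle).comp h₁ continuous_id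
    have h₄ := (IsContFam.snd E.toVBundle F.toVBundle).comp h₁ continuous_id
    have h₅ := h₃.pair (h₄.pair h₂)
    refine IsContFam.congr (a := id) (b := id) h₅ fun x => ?_
    have key : (LinearMap.fst ℂ (E.fib x) (F.fib x) ∘ₗ LinearMap.fst ℂ _ (G.fib x)).prod
        ((LinearMap.snd ℂ (E.fib x) (F.fib x) ∘ₗ LinearMap.fst ℂ _ (G.fib x)).prod
          (LinearMap.snd ℂ _ _)) =
        (LinearEquiv.prodAssoc ℂ (E.fib x) (F.fib x) (G.fib x)).toLinearMap := rfl
    exact key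
  continuous_symm := by
    have h₁ := IsContFam.fst E.toVBundle (F.toVBundle.sum G.toVBundle)
    have h₂ := IsContFam.snd E.toVBundle (F.toVBundle.sum G.toVBundle)
    have h₃ := (IsContFam.fst F.toVBundle G.toVBundle).comp h₂ continuous_id
    have h₄ := (IsContFam.snd F.toVBundle G.toVBundle).comp h₂ continuous_id
    have h₅ := (h₁.pair h₃).pair h₄
    refine IsContFam.congr (a := id) (b := id) h₅ fun x => ?_
    have key : ((LinearMap.fst ℂ (E.fib x) (F.fib x × G.fib x)).prod
        (LinearMap.fst ℂ (F.fib x) (G.fib x) ∘ₗ LinearMap.snd ℂ _ _)).prod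
        (LinearMap.snd ℂ (F.fib x) (G.fib x) ∘ₗ LinearMap.snd ℂ _ _) =
        (LinearEquiv.prodAssoc ℂ (E.fib x) (F.fib x) (G.fib x)).symm.toLinearMap := rfl
    exact key

def zeroSum (E : TBundle T X) : Iso ((zero T X).sum E) E where
  toEquiv _ :=
    { toFun := fun v => v.2
      invFun := fun v => (PUnit.unit, v)
      map_add' := fun _ _ => rfl
      map_smul' := fun _ _ => rfl
      left_inv := fun _ => rfl
      right_inv := fun _ => rfl }
  equivariant _ _ _ _ _ := rfl
  continuous_toEquiv := by
    have h := IsContFam.snd (zero T X).toVBundle E.toVBundle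
    exact h
  continuous_symm := by
    have h := IsContFam.inr (zero T X).toVBundle E.toVBundle
    exact h

def zeroTensor (E : TBundle T X) : Iso ((zero T X).tensor E) (zero T X) where
  toEquiv x :=
    { toFun := fun _ => PUnit.unit
      invFun := fun _ => (0 : PUnit ⊗[ℂ] E.fib x)
      map_add' := fun _ _ => rfl
      map_smul' := fun _ _ => rfl
      left_inv := fun _ => Subsingleton.elim (α := PUnit ⊗[ℂ] E.fib x) _ _
      right_inv := fun _ => rfl }
  equivariant _ _ _ _ _ := rfl
  continuous_toEquiv _ _ j := Empty.elim j.1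
  continuous_symm _ _ j := Empty.elim j

def tensorSum (E F G : TBundle T X) :
    Iso (E.tensor (F.sum G)) ((E.tensor F).sum (E.tensor G)) where
  toEquiv x := TensorProduct.prodRight ℂ ℂ (E.fib x) (F.fib x) (G.fib x)
  equivariant t x y h v := by
    have key : (TensorProduct.prodRight ℂ ℂ (E.fib y) (F.fib y) (G.fib y)).toLinearMap ∘ₗ
        TensorProduct.map (E.act t h) ((F.act t h).prodMap (G.act t h)) =
        (TensorProduct.map (E.act t h) (F.act t h)).prodMap
          (TensorProduct.map (E.act t h) (G.act t h)) ∘ₗ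
          (TensorProduct.prodRight ℂ ℂ (E.fib x) (F.fib x) (G.fib x)).toLinearMap :=
      TensorProduct.ext' fun _ _ => rfl
    exact LinearMap.congr_fun key v
  continuous_toEquiv := by
    have h₁ := (isContFam_id E.toVBundle).tensorMap (IsContFam.fst F.toVBundle G.toVBundle)
    have h₂ := (isContFam_id E.toVBundle).tensorMap (IsContFam.snd F.toVBundle G.toVBundle)
    refine IsContFam.congr (a := id) (b := id) (h₁.pair h₂) fun x => ?_
    have key : (TensorProduct.map LinearMap.id (LinearMap.fst ℂ (F.fib x) (G.fib x))).prod
        (TensorProduct.map LinearMap.id (LinearMap.snd ℂ (F.fib x) (G.fib x))) =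
        (TensorProduct.prodRight ℂ ℂ (E.fib x) (F.fib x) (G.fib x)).toLinearMap :=
      TensorProduct.ext' fun _ _ => rfl
    exact key
  continuous_symm := by
    have h₁ := (isContFam_id E.toVBundle).tensorMap (IsContFam.inl F.toVBundle G.toVBundle)
    have h₂ := (isContFam_id E.toVBundle).tensorMap (IsContFam.inr F.toVBundle G.toVBundle)
    refine IsContFam.congr (a := id) (b := id) (h₁.coprod h₂) fun x => ?_
    have key : (TensorProduct.map LinearMap.id (LinearMap.inl ℂ (F.fib x) (G.fib x))).coprod
        (TensorProduct.map LinearMap.id (LinearMap.inr ℂ (F.fib x) (G.fib x))) =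
        (TensorProduct.prodRight ℂ ℂ (E.fib x) (F.fib x) (G.fib x)).symm.toLinearMap := by
      refine LinearMap.prod_ext ?_ ?_ <;>
        exact TensorProduct.ext' fun a b => by simp [LinearEquiv.eq_symm_apply]
    exact key

def tensorComm (E F : TBundle T X) : Iso (E.tensor F) (F.tensor E) where
  toEquiv x := TensorProduct.comm ℂ (E.fib x) (F.fib x)
  equivariant t x y h v := by
    have key : (TensorProduct.comm ℂ (E.fib y) (F.fib y)).toLinearMap ∘ₗ
        TensorProduct.map (E.act t h) (F.act t h) = TensorProduct.map (F.act t h) (E.act t h) ∘ₗ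
          (TensorProduct.comm ℂ (E.fib x) (F.fib x)).toLinearMap :=
      TensorProduct.ext' fun _ _ => rfl
    exact LinearMap.congr_fun key v
  continuous_toEquiv := IsContFam.tensorComm _ _
  continuous_symm := IsContFam.tensorComm _ _

def oneTensor (E : TBundle T X) : Iso ((one T X).tensor E) E where
  toEquiv x := TensorProduct.lid ℂ (E.fib x)
  equivariant t x y h v := by
    have key : (TensorProduct.lid ℂ (E.fib y)).toLinearMap ∘ₗ
        TensorProduct.map LinearMap.id (E.act t h) =
        E.act t h ∘ₗ (TensorProduct.lid ℂ (E.fib x)).toLinearMap :=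
      TensorProduct.ext' fun a b => by simp
    exact LinearMap.congr_fun key v
  continuous_toEquiv := IsContFam.lid _
  continuous_symm := IsContFam.lid_symm _

def tensorAssoc (E F G : TBundle T X) :
    Iso ((E.tensor F).tensor G) (E.tensor (F.tensor G)) where
  toEquiv x := TensorProduct.assoc ℂ (E.fib x) (F.fib x) (G.fib x)
  equivariant t x y h v := by
    have key : (TensorProduct.assoc ℂ (E.fib y) (F.fib y) (G.fib y)).toLinearMap ∘ₗ
        TensorProduct.map (TensorProduct.map (E.act t h) (F.act t h)) (G.act t h) =
        TensorProduct.map (E.act t h) (TensorProduct.map (F.act t h) (G.act t h)) ∘ₗ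
          (TensorProduct.assoc ℂ (E.fib x) (F.fib x) (G.fib x)).toLinearMap :=
      TensorProduct.ext_threefold fun _ _ _ => rfl
    exact LinearMap.congr_fun key v
  continuous_toEquiv := IsContFam.assoc _ _ _
  continuous_symm := IsContFam.assoc_symm _ _ _

end Iso

end TBundle

/-! ### The Grothendieck ring of a commutative semiring -/

section Grothendieck

open Algebra

variable {S : Type u} [CommSemiring S]

theorem GrothendieckAddGroup.lift_of {M A : Type*} [AddCommMonoid M] [AddCommGroup A] (f : M →+ A)
    (a : M) : GrothendieckAddGroup.lift f (GrothendieckAddGroup.of a) = f a :=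
  DFunLike.congr_fun (GrothendieckAddGroup.lift.symm_apply_apply f) a

theorem GrothendieckAddGroup.exists_sub {M : Type*} [AddCommMonoid M]
    (x : GrothendieckAddGroup M) :
    ∃ a b : M, x = GrothendieckAddGroup.of a - GrothendieckAddGroup.of b := by
  induction x using AddLocalization.ind with
  | H y =>
    obtain ⟨a, b⟩ := y
    refine ⟨a, b, ?_⟩
    rw [eq_sub_iff_add_eq]
    change AddLocalization.mk a b + (AddLocalization.addMonoidOf ⊤) b.1 =
      (AddLocalization.addMonoidOf ⊤) a
    rw [← AddLocalization.mk_zero_eq_addMonoidOf_mk, ← AddLocalization.mk_zero_eq_addMonoidOf_mk,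
      AddLocalization.mk_add, AddLocalization.mk_eq_mk_iff, AddLocalization.r_iff_exists]
    exact ⟨0, by simp [add_comm]⟩

/-- The multiplication of the Grothendieck ring, determined by `[a] [b] = [a b]`. -/
def groMul (S : Type u) [CommSemiring S] :
    GrothendieckAddGroup S →+ GrothendieckAddGroup S →+ GrothendieckAddGroup S :=
  GrothendieckAddGroup.lift
    { toFun := fun a => GrothendieckAddGroup.lift
        ((GrothendieckAddGroup.of (M := S)).comp (AddMonoidHom.mulLeft a))
      map_zero' := GrothendieckAddGroup.lift.symm.injective (by ext; simp)
      map_add' := fun a b => GrothendieckAddGroup.lift.symm.injective (by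
        ext c
        have h := fun a : S => GrothendieckAddGroup.lift_of
          ((GrothendieckAddGroup.of (M := S)).comp (AddMonoidHom.mulLeft a)) c
        refine (h (a + b)).trans (Eq.trans ?_ (congrArg₂ (· + ·) (h a) (h b)).symm)
        simp [add_mul]) }

theorem groMul_of (a b : S) : groMul S (GrothendieckAddGroup.of a) (GrothendieckAddGroup.of b) =
    GrothendieckAddGroup.of (a * b) := by
  rw [groMul, GrothendieckAddGroup.lift_of]
  exact GrothendieckAddGroup.lift_of _ b

/-- The ring completion of a commutative semiring, on Mathlib's Grothendieck group of its additive
monoid. -/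
abbrev groRing (S : Type u) [CommSemiring S] : CommRing (GrothendieckAddGroup S) :=
  { (inferInstance : AddCommGroup (GrothendieckAddGroup S)) with
    mul := fun x y => groMul S x y
    one := GrothendieckAddGroup.of 1
    left_distrib := fun x y z => map_add (groMul S x) y z
    right_distrib := fun x y z => by
      change groMul S (x + y) z = groMul S x z + groMul S y z
      rw [map_add, AddMonoidHom.add_apply]
    zero_mul := fun x => by
      change groMul S 0 x = 0
      rw [map_zero, AddMonoidHom.zero_apply]
    mul_zero := fun x => map_zero (groMul S x)
    mul_comm := fun x y => by
      change groMul S x y = groMul S y x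
      obtain ⟨a, b, rfl⟩ := GrothendieckAddGroup.exists_sub x
      obtain ⟨c, d, rfl⟩ := GrothendieckAddGroup.exists_sub y
      simp only [map_sub, AddMonoidHom.sub_apply, groMul_of, mul_comm]
      abel
    mul_assoc := fun x y z => by
      change groMul S (groMul S x y) z = groMul S x (groMul S y z)
      obtain ⟨a, b, rfl⟩ := GrothendieckAddGroup.exists_sub x
      obtain ⟨c, d, rfl⟩ := GrothendieckAddGroup.exists_sub y
      obtain ⟨e, f, rfl⟩ := GrothendieckAddGroup.exists_sub z
      simp only [map_sub, AddMonoidHom.sub_apply, groMul_of, mul_assoc]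
    one_mul := fun x => by
      change groMul S (GrothendieckAddGroup.of 1) x = x
      obtain ⟨a, b, rfl⟩ := GrothendieckAddGroup.exists_sub x
      simp only [map_sub, groMul_of, one_mul]
    mul_one := fun x => by
      change groMul S x (GrothendieckAddGroup.of 1) = x
      obtain ⟨a, b, rfl⟩ := GrothendieckAddGroup.exists_sub x
      simp only [map_sub, AddMonoidHom.sub_apply, groMul_of, mul_one] }

end Grothendieck

/-! ### Equivariant K-theory -/

section KTheory

variable (T : Type v) (X : Type u) [Group T] [TopologicalSpace T] [TopologicalSpace X]
  [MulAction T X]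

instance TBundle.setoid : Setoid (TBundle T X) where
  r E F := Nonempty (TBundle.Iso E F)
  iseqv := ⟨fun E => ⟨TBundle.Iso.refl E⟩, fun ⟨e⟩ => ⟨e.symm⟩, fun ⟨e⟩ ⟨f⟩ => ⟨e.trans f⟩⟩

/-- Isomorphism classes of `T`-equivariant complex vector bundles over `X`. -/
def Vect : Type (max u v 1) := Quotient (TBundle.setoid T X)

instance Vect.instZero : Zero (Vect T X) := ⟨Quotient.mk _ (TBundle.zero T X)⟩

instance Vect.instAdd : Add (Vect T X) :=
  ⟨Quotient.map₂ TBundle.sum fun _ _ ⟨e⟩ _ _ ⟨f⟩ => ⟨e.sumCongr f⟩⟩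

/-- The semiring structure on isomorphism classes given by `⊕` and `⊗`. -/
instance Vect.instCommSemiring : CommSemiring (Vect T X) where
  mul := Quotient.map₂ TBundle.tensor fun _ _ ⟨e⟩ _ _ ⟨f⟩ => ⟨e.tensorCongr f⟩
  one := Quotient.mk _ (TBundle.one T X)
  nsmul := nsmulRec
  add_comm := by
    rintro ⟨E⟩ ⟨F⟩
    exact Quotient.sound ⟨TBundle.Iso.sumComm E F⟩
  add_assoc := by
    rintro ⟨E⟩ ⟨F⟩ ⟨G⟩
    exact Quotient.sound ⟨TBundle.Iso.sumAssoc E F G⟩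
  zero_add := by
    rintro ⟨E⟩
    exact Quotient.sound ⟨TBundle.Iso.zeroSum E⟩
  add_zero := by
    rintro ⟨E⟩
    exact Quotient.sound ⟨(TBundle.Iso.sumComm _ _).trans (TBundle.Iso.zeroSum E)⟩
  mul_comm := by
    rintro ⟨E⟩ ⟨F⟩
    exact Quotient.sound ⟨TBundle.Iso.tensorComm E F⟩
  mul_assoc := by
    rintro ⟨E⟩ ⟨F⟩ ⟨G⟩
    exact Quotient.sound ⟨TBundle.Iso.tensorAssoc E F G⟩
  one_mul := by
    rintro ⟨E⟩
    exact Quotient.sound ⟨TBundle.Iso.oneTensor E⟩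
  mul_one := by
    rintro ⟨E⟩
    exact Quotient.sound ⟨(TBundle.Iso.tensorComm _ _).trans (TBundle.Iso.oneTensor E)⟩
  zero_mul := by
    rintro ⟨E⟩
    exact Quotient.sound ⟨TBundle.Iso.zeroTensor E⟩
  mul_zero := by
    rintro ⟨E⟩
    exact Quotient.sound ⟨(TBundle.Iso.tensorComm _ _).trans (TBundle.Iso.zeroTensor E)⟩
  left_distrib := by
    rintro ⟨E⟩ ⟨F⟩ ⟨G⟩
    exact Quotient.sound ⟨TBundle.Iso.tensorSum E F G⟩
  right_distrib := by
    rintro ⟨E⟩ ⟨F⟩ ⟨G⟩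
    exact Quotient.sound ⟨((TBundle.Iso.tensorComm _ _).trans (TBundle.Iso.tensorSum G E F)).trans
      ((TBundle.Iso.tensorComm _ _).sumCongr (TBundle.Iso.tensorComm _ _))⟩

/-- The equivariant K-theory ring `K_T(X)`: the Grothendieck ring of `T`-equivariant complex
vector bundles over `X`. -/
def KT : Type (max u v 1) := Algebra.GrothendieckAddGroup (Vect T X)

instance KT.instCommRing : CommRing (KT T X) := groRing (Vect T X)

variable {T X}

/-- The class `[E]` in `K_T(X)`. -/
def KT.of (E : TBundle T X) : KT T X :=
  Algebra.GrothendieckAddGroup.of (M := Vect T X) (Quotient.mk _ E)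

/-- The K-theoretic Euler class `λ₋₁(E*) = ∑ₖ (-1)ᵏ [Λᵏ E*]`. -/
def KT.euler [ContinuousInv T] [ContinuousSMul T X] (E : TBundle T X) : KT T X :=
  ∑ᶠ k : ℕ, (-1) ^ k * KT.of (E.dual.ext k)

variable {Y : Type w} [TopologicalSpace Y] [MulAction T Y]

def TBundle.Iso.pullbackCongr {E F : TBundle T X} (e : TBundle.Iso E F) (f : Y → X)
    (hf : Continuous f) (hf' : ∀ (t : T) y, f (t • y) = t • f y) :
    TBundle.Iso (E.pullback f hf hf') (F.pullback f hf hf') where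
  toEquiv y := e.toEquiv (f y)
  equivariant t _ _ _ v := e.equivariant t _ _ _ v
  continuous_toEquiv y₀ y₁ j i := e.continuous_toEquiv.param hf (f y₀) (f y₁) j i
  continuous_symm y₀ y₁ j i := e.continuous_symm.param hf (f y₀) (f y₁) j i

/-- Pullback of isomorphism classes of equivariant bundles. -/
def Vect.pullback (f : Y → X) (hf : Continuous f) (hf' : ∀ (t : T) y, f (t • y) = t • f y) :
    Vect T X →+* Vect T Y where
  toFun := Quotient.map (fun E => E.pullback f hf hf') fun _ _ ⟨e⟩ => ⟨e.pullbackCongr f hf hf'⟩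
  map_zero' := rfl
  map_one' := rfl
  map_add' := by
    rintro ⟨E⟩ ⟨F⟩
    rfl
  map_mul' := by
    rintro ⟨E⟩ ⟨F⟩
    rfl

/-- Pullback `f^* : K_T(X) → K_T(Y)` along a continuous equivariant map `f : Y → X`. -/
def KT.pullback (f : Y → X) (hf : Continuous f) (hf' : ∀ (t : T) y, f (t • y) = t • f y) :
    KT T X →+* KT T Y :=
  let φ : Algebra.GrothendieckAddGroup (Vect T X) →+ Algebra.GrothendieckAddGroup (Vect T Y) :=
    Algebra.GrothendieckAddGroup.lift
      (Algebra.GrothendieckAddGroup.of.comp (Vect.pullback f hf hf').toAddMonoidHom)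
  have hφ : ∀ a, φ (Algebra.GrothendieckAddGroup.of a) =
      Algebra.GrothendieckAddGroup.of (Vect.pullback f hf hf' a) :=
    fun a => GrothendieckAddGroup.lift_of _ a
  { toFun := φ
    map_zero' := map_zero φ
    map_add' := map_add φ
    map_one' := (hφ 1).trans (congrArg _ (map_one (Vect.pullback f hf hf')))
    map_mul' := fun x y => by
      change φ (groMul _ x y) = groMul _ (φ x) (φ y)
      obtain ⟨a, b, rfl⟩ := GrothendieckAddGroup.exists_sub x
      obtain ⟨c, d, rfl⟩ := GrothendieckAddGroup.exists_sub y
      simp only [map_sub, AddMonoidHom.sub_apply, groMul_of, hφ, map_mul] }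

/-- `K_T(X)` is an algebra over `K_T(pt)` through the map `X → pt`. -/
instance KT.instAlgebra : Algebra (KT T PUnit.{1}) (KT T X) :=
  (KT.pullback (fun _ : X => PUnit.unit) continuous_const (fun _ _ => rfl)).toAlgebra

end KTheory

/-! ### Retracts of vector bundles -/

/-- A family of vector spaces `Q x` that is fibrewise a retract of a vector bundle `E`, such that
the resulting idempotents of the fibres of `E` are continuous. -/
structure Retract {X : Type u} [TopologicalSpace X] (E : VBundle X) where
  Q : X → Type
  [instAddCommGroup : ∀ x, AddCommGroup (Q x)]
  [instModule : ∀ x, Module ℂ (Q x)]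
  i : ∀ x, Q x →ₗ[ℂ] E.fib x
  r : ∀ x, E.fib x →ₗ[ℂ] Q x
  r_i : ∀ x v, r x (i x v) = v
  continuous_i_r : IsContFam E E id id (fun x => i x ∘ₗ r x)

attribute [instance] Retract.instAddCommGroup Retract.instModule

namespace Retract

open scoped Matrix Classical

variable {X : Type u} [TopologicalSpace X] {E : VBundle X} (D : Retract E)

instance (x : X) : Fintype (E.idx x) := Fintype.ofFinite _

/-- The matrix of the idempotent in the frame around `x₀`. -/
def mat (x₀ : X) (x : E.nhd x₀) : Matrix (E.idx x₀) (E.idx x₀) ℂ :=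
  fun k l => (E.frame x₀ x.1 x.2).repr (D.i x.1 (D.r x.1 (E.frame x₀ x.1 x.2 l))) k

theorem continuous_mat (x₀ : X) : Continuous (D.mat x₀) :=
  continuous_matrix fun k l => (D.continuous_i_r x₀ x₀ l k).comp
    (f := fun x : E.nhd x₀ => (⟨x.1, x.2, x.2⟩ : {z : X // z ∈ E.nhd x₀ ∧ z ∈ E.nhd x₀}))
    (continuous_subtype_val.subtype_mk _)

theorem mat_mulVec (x₀ : X) (x : E.nhd x₀) (v : E.fib x.1) :
    D.mat x₀ x *ᵥ (E.frame x₀ x.1 x.2).equivFun v =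
      (E.frame x₀ x.1 x.2).equivFun (D.i x.1 (D.r x.1 v)) := by
  ext k
  rw [Basis.equivFun_apply, Basis.equivFun_apply, ← Basis.coord_apply]
  conv_rhs => rw [← (E.frame x₀ x.1 x.2).sum_repr v]
  simp only [map_sum, map_smul, Basis.coord_apply, mat, Matrix.mulVec, dotProduct,
    smul_eq_mul, mul_comm]

theorem mat_mul_mat (x₀ : X) (x : E.nhd x₀) : D.mat x₀ x * D.mat x₀ x = D.mat x₀ x := by
  refine Matrix.ext_of_mulVec_single fun k => ?_
  obtain ⟨v, hv⟩ := (E.frame x₀ x.1 x.2).equivFun.surjective (Pi.single k 1)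
  rw [← hv, ← Matrix.mulVec_mulVec, mat_mulVec, mat_mulVec, D.r_i]

/-- The matrix `p q + (1 - p) (1 - q)` intertwining the idempotents at `x` and at `x₀`. -/
def twist (x₀ : X) (x : E.nhd x₀) : Matrix (E.idx x₀) (E.idx x₀) ℂ :=
  D.mat x₀ x * D.mat x₀ ⟨x₀, E.mem_nhd x₀⟩ +
    (1 - D.mat x₀ x) * (1 - D.mat x₀ ⟨x₀, E.mem_nhd x₀⟩)

theorem continuous_twist (x₀ : X) : Continuous (D.twist x₀) := by
  have h := D.continuous_mat x₀
  unfold twist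
  fun_prop

theorem twist_self (x₀ : X) : D.twist x₀ ⟨x₀, E.mem_nhd x₀⟩ = 1 := by
  have h := D.mat_mul_mat x₀ ⟨x₀, E.mem_nhd x₀⟩
  simp only [twist, mul_sub, sub_mul, h, mul_one, one_mul]
  abel

/-- The points near `x₀` at which the retract is framed. -/
def nhd (x₀ : X) : Set X := {x | ∃ h : x ∈ E.nhd x₀, (D.twist x₀ ⟨x, h⟩).det ≠ 0}

theorem isOpen_nhd (x₀ : X) : IsOpen (D.nhd x₀) := by
  have h : D.nhd x₀ = Subtype.val '' {x : E.nhd x₀ | (D.twist x₀ x).det ≠ 0} := by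
    ext x
    simp [nhd]
  rw [h]
  exact (E.isOpen_nhd x₀).isOpenMap_subtype_val _
    (isOpen_ne_fun (D.continuous_twist x₀).matrix_det continuous_const)

theorem mem_nhd (x₀ : X) : x₀ ∈ D.nhd x₀ := ⟨E.mem_nhd x₀, by simp [twist_self]⟩

/-- The coordinates of `i v` in the frame of `E` around `x₀`. -/
def coords (x₀ : X) (x : E.nhd x₀) : D.Q x.1 →ₗ[ℂ] (E.idx x₀ → ℂ) :=
  (E.frame x₀ x.1 x.2).equivFun.toLinearMap ∘ₗ D.i x.1

/-- The vector of `Q x` with given coordinates. -/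
def ofCoords (x₀ : X) (x : E.nhd x₀) : (E.idx x₀ → ℂ) →ₗ[ℂ] D.Q x.1 :=
  D.r x.1 ∘ₗ (E.frame x₀ x.1 x.2).equivFun.symm.toLinearMap

theorem ofCoords_coords (x₀ : X) (x : E.nhd x₀) (v) :
    D.ofCoords x₀ x (D.coords x₀ x v) = v := by
  simp [ofCoords, coords, D.r_i]

theorem coords_ofCoords (x₀ : X) (x : E.nhd x₀) (u) :
    D.coords x₀ x (D.ofCoords x₀ x u) = D.mat x₀ x *ᵥ u := by
  obtain ⟨v, rfl⟩ := (E.frame x₀ x.1 x.2).equivFun.surjective u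
  rw [mat_mulVec]
  simp [ofCoords, coords]

theorem mat_coords (x₀ : X) (x : E.nhd x₀) (v) :
    D.mat x₀ x *ᵥ D.coords x₀ x v = D.coords x₀ x v := by
  rw [← coords_ofCoords, ofCoords_coords]

theorem ofCoords_mat (x₀ : X) (x : E.nhd x₀) (u) :
    D.ofCoords x₀ x (D.mat x₀ x *ᵥ u) = D.ofCoords x₀ x u := by
  rw [← coords_ofCoords, ofCoords_coords]

theorem mat_mul_twist (x₀ : X) (x : E.nhd x₀) :
    D.mat x₀ x * D.twist x₀ x = D.mat x₀ x * D.mat x₀ ⟨x₀, E.mem_nhd x₀⟩ := by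
  have h := D.mat_mul_mat x₀ x
  rw [twist, mul_add, ← mul_assoc, ← mul_assoc, mul_sub (D.mat x₀ x), h, mul_one, sub_self,
    zero_mul, add_zero]

theorem twist_mul_mat (x₀ : X) (x : E.nhd x₀) :
    D.twist x₀ x * D.mat x₀ ⟨x₀, E.mem_nhd x₀⟩ =
      D.mat x₀ x * D.mat x₀ ⟨x₀, E.mem_nhd x₀⟩ := by
  have h := D.mat_mul_mat x₀ ⟨x₀, E.mem_nhd x₀⟩
  rw [twist, add_mul, mul_assoc, mul_assoc, sub_mul _ _ (D.mat x₀ ⟨x₀, E.mem_nhd x₀⟩), h, one_mul,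
    sub_self, mul_zero, add_zero]

/-- The identification of `Q x₀` with `Q x` for `x` near `x₀`. -/
def fibEquiv (x₀ : X) (x : E.nhd x₀) (hx : (D.twist x₀ x).det ≠ 0) : D.Q x₀ ≃ₗ[ℂ] D.Q x.1 :=
  LinearEquiv.ofLinearMap
    (D.ofCoords x₀ x ∘ₗ D.coords x₀ ⟨x₀, E.mem_nhd x₀⟩)
    (D.ofCoords x₀ ⟨x₀, E.mem_nhd x₀⟩ ∘ₗ Matrix.mulVecLin (D.twist x₀ x)⁻¹ ∘ₗ D.coords x₀ x)
    (by
      refine LinearMap.ext fun q => ?_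
      have hu : IsUnit (D.twist x₀ x).det := isUnit_iff_ne_zero.2 hx
      simp only [LinearMap.comp_apply, Matrix.mulVecLin_apply, LinearMap.id_apply,
        D.coords_ofCoords x₀ ⟨x₀, E.mem_nhd x₀⟩]
      rw [← ofCoords_mat]
      rw [Matrix.mulVec_mulVec, ← mat_mul_twist, Matrix.mulVec_mulVec, mul_assoc,
        Matrix.mul_nonsing_inv _ hu, mul_one, mat_coords, ofCoords_coords])
    (by
      refine LinearMap.ext fun q => ?_
      have hu : IsUnit (D.twist x₀ x).det := isUnit_iff_ne_zero.2 hx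
      simp only [LinearMap.comp_apply, Matrix.mulVecLin_apply, LinearMap.id_apply,
        coords_ofCoords]
      conv_lhs => rw [← mat_coords]
      rw [Matrix.mulVec_mulVec, Matrix.mulVec_mulVec, mul_assoc, ← twist_mul_mat, ← mul_assoc,
        Matrix.nonsing_inv_mul _ hu, one_mul, mat_coords, ofCoords_coords])

instance (x : X) : Module.Finite ℂ (D.Q x) :=
  have : Module.Finite ℂ (E.fib x) := Module.Finite.of_basis (E.frame x x (E.mem_nhd x))
  Module.Finite.of_surjective (D.r x) fun v => ⟨D.i x v, D.r_i x v⟩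

/-- The local frames of the retract. -/
def frame (x₀ x : X) (hx : x ∈ D.nhd x₀) : Basis (Fin (finrank ℂ (D.Q x₀))) ℂ (D.Q x) :=
  (Module.finBasis ℂ (D.Q x₀)).map (D.fibEquiv x₀ ⟨x, hx.1⟩ hx.2)

theorem continuous_frame_repr {Z : Type*} [TopologicalSpace Z] (x₁ : X) (b : Z → X)
    (hbc : Continuous b) (hb : ∀ z, b z ∈ D.nhd x₁) (v : ∀ z, D.Q (b z))
    (hv : ∀ k, Continuous fun z => (E.frame x₁ (b z) (hb z).1).repr (D.i (b z) (v z)) k)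
    (k : Fin (finrank ℂ (D.Q x₁))) :
    Continuous fun z => (D.frame x₁ (b z) (hb z)).repr (v z) k := by
  let Λ : (E.idx x₁ → ℂ) →ₗ[ℂ] ℂ :=
    (Module.finBasis ℂ (D.Q x₁)).coord k ∘ₗ D.ofCoords x₁ ⟨x₁, E.mem_nhd x₁⟩
  have hΛ : Continuous Λ := LinearMap.continuous_of_finiteDimensional Λ
  have key : ∀ z, (D.frame x₁ (b z) (hb z)).repr (v z) k =
      Λ ((D.twist x₁ ⟨b z, (hb z).1⟩)⁻¹ *ᵥ D.coords x₁ ⟨b z, (hb z).1⟩ (v z)) := fun z => rfl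
  simp only [key]
  refine hΛ.comp ?_
  have hM : Continuous fun z => D.twist x₁ ⟨b z, (hb z).1⟩ :=
    (D.continuous_twist x₁).comp (hbc.subtype_mk fun z => (hb z).1)
  have hMi : Continuous fun z => (D.twist x₁ ⟨b z, (hb z).1⟩)⁻¹ := by
    simp only [Matrix.inv_def, Ring.inverse_eq_inv']
    exact (hM.matrix_det.inv₀ fun z => (hb z).2).smul hM.matrix_adjugate
  exact hMi.matrix_mulVec (continuous_pi fun l => hv l)

theorem continuous_i_frame (x₀ x₁ : X) (j) (k) :
    Continuous fun z : {z : X // z ∈ D.nhd x₀ ∧ z ∈ E.nhd x₁} =>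
      (E.frame x₁ z.1 z.2.2).repr (D.i z.1 (D.frame x₀ z.1 z.2.1 j)) k := by
  let u : E.idx x₀ → ℂ := D.coords x₀ ⟨x₀, E.mem_nhd x₀⟩ (Module.finBasis ℂ (D.Q x₀) j)
  have key : ∀ z : {z : X // z ∈ D.nhd x₀ ∧ z ∈ E.nhd x₁},
      (E.frame x₁ z.1 z.2.2).repr (D.i z.1 (D.frame x₀ z.1 z.2.1 j)) k =
      ∑ l, u l * (E.frame x₁ z.1 z.2.2).repr
        (D.i z.1 (D.r z.1 (E.frame x₀ z.1 z.2.1.1 l))) k := by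
    intro z
    have h : D.frame x₀ z.1 z.2.1 j =
        D.r z.1 ((E.frame x₀ z.1 z.2.1.1).equivFun.symm u) := rfl
    rw [h, Basis.equivFun_symm_apply]
    simp [map_sum, Finsupp.finsetSum_apply]
  simp only [key]
  refine continuous_finsetSum _ fun l _ => continuous_const.mul ?_
  exact (D.continuous_i_r x₀ x₁ l k).comp
    (f := fun z : {z : X // z ∈ D.nhd x₀ ∧ z ∈ E.nhd x₁} =>
      (⟨z.1, z.2.1.1, z.2.2⟩ : {z : X // z ∈ E.nhd x₀ ∧ z ∈ E.nhd x₁}))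
    (continuous_subtype_val.subtype_mk _)

/-- A retract of a vector bundle is a vector bundle. -/
def bundle : VBundle X where
  fib := D.Q
  nhd := D.nhd
  isOpen_nhd := D.isOpen_nhd
  mem_nhd := D.mem_nhd
  idx x := Fin (finrank ℂ (D.Q x))
  frame := D.frame
  continuous_transition x₀ x₁ j i :=
    D.continuous_frame_repr x₁ (fun z : {z : X // z ∈ D.nhd x₀ ∧ z ∈ D.nhd x₁} => z.1)
      continuous_subtype_val (fun z => z.2.2) (fun z => D.frame x₀ z.1 z.2.1 j)
      (fun k => (D.continuous_i_frame x₀ x₁ j k).comp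
        (f := fun z : {z : X // z ∈ D.nhd x₀ ∧ z ∈ D.nhd x₁} =>
          (⟨z.1, z.2.1, z.2.2.1⟩ : {z : X // z ∈ D.nhd x₀ ∧ z ∈ E.nhd x₁}))
        (continuous_subtype_val.subtype_mk _)) i

theorem continuous_i : IsContFam D.bundle E id id D.i :=
  fun x₀ x₁ j k => D.continuous_i_frame x₀ x₁ j k

theorem continuous_r : IsContFam E D.bundle id id D.r := fun x₀ x₁ j k =>
  D.continuous_frame_repr x₁ (fun z : {z : X // z ∈ E.nhd x₀ ∧ z ∈ D.nhd x₁} => z.1)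
    continuous_subtype_val (fun z => z.2.2) (fun z => D.r z.1 (E.frame x₀ z.1 z.2.1 j))
    (fun k => (D.continuous_i_r x₀ x₁ j k).comp
      (f := fun z : {z : X // z ∈ E.nhd x₀ ∧ z ∈ D.nhd x₁} =>
        (⟨z.1, z.2.1, z.2.2.1⟩ : {z : X // z ∈ E.nhd x₀ ∧ z ∈ E.nhd x₁}))
      (continuous_subtype_val.subtype_mk _)) k

end Retract

/-! ### Isotypic subbundles over a space with trivial action -/

theorem continuous_integral_of_compact {T : Type v} {Z : Type w} [TopologicalSpace T]
    [TopologicalSpace Z] [CompactSpace T] [MeasurableSpace T] [BorelSpace T]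
    (m : MeasureTheory.Measure T) [MeasureTheory.IsFiniteMeasure m] (f : Z × T → ℂ)
    (hf : Continuous f) : Continuous fun z => ∫ t, f (z, t) ∂m := by
  let F : C(Z, C(T, ℂ)) := ContinuousMap.curry ⟨f, hf⟩
  have hI : Continuous fun g : C(T, ℂ) => ∫ t, g t ∂m := by
    have hint : ∀ g : C(T, ℂ), MeasureTheory.Integrable g m := fun g =>
      (MeasureTheory.integrable_const ‖g‖).mono' g.continuous.aestronglyMeasurable
        (Filter.Eventually.of_forall fun t => g.norm_coe_le_norm t)
    refine (LipschitzWith.of_dist_le_mul (K := (m.real Set.univ).toNNReal) fun g h => ?_).continuous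
    rw [dist_eq_norm, ← MeasureTheory.integral_sub (hint g) (hint h), dist_eq_norm,
      Real.coe_toNNReal _ MeasureTheory.measureReal_nonneg, mul_comm]
    exact MeasureTheory.norm_integral_le_of_norm_le_const
      (Filter.Eventually.of_forall fun t => (g - h).norm_coe_le_norm t)
  exact hI.comp F.continuous

namespace TBundle

variable {T : Type v} {X : Type u} [Group T] [TopologicalSpace T] [TopologicalSpace X]
  [MulAction T X]

theorem continuous_act_of_trivial (E : TBundle T X) (htriv : ∀ (t : T) (x : X), t • x = x) :
    IsContFam E.toVBundle E.toVBundle (fun p : T × X => p.2) (fun p => p.2)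
      (fun p => E.act p.1 (htriv p.1 p.2)) := by
  have key : ∀ (b : T × X → X) (hb : ∀ p, p.1 • p.2 = b p),
      IsContFam E.toVBundle E.toVBundle (fun p : T × X => p.2) b
        (fun p => E.act p.1 (hb p)) := by
    intro b hb
    obtain rfl : b = fun p => p.1 • p.2 := funext fun p => (hb p).symm
    exact E.continuous_act
  exact key _ _

theorem continuous_proj_smul (_E : TBundle T X) (htriv : ∀ (t : T) (x : X), t • x = x) :
    Continuous fun p : T × X => p.1 • p.2 := by
  simp only [htriv]
  exact continuous_snd

/-- The subspace of the fibre at a fixed point on which `T` acts with weight `μ`. -/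
def weightSpace (E : TBundle T X) (htriv : ∀ (t : T) (x : X), t • x = x)
    (μ : T →ₜ* Circle) (x : X) : Submodule ℂ (E.fib x) where
  carrier := {v | ∀ t : T, E.act t (htriv t x) v = (μ t : ℂ) • v}
  add_mem' {a b} ha hb t := by rw [map_add, ha t, hb t, smul_add]
  zero_mem' t := by rw [map_zero, smul_zero]
  smul_mem' c v hv t := by rw [map_smul, hv t, smul_comm]

theorem act_mem_weightSpace (E : TBundle T X) (htriv : ∀ (t : T) (x : X), t • x = x)
    (μ : T →ₜ* Circle) (t : T) {x y : X} (h : t • x = y) (v : E.fib x)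
    (hv : v ∈ E.weightSpace htriv μ x) : E.act t h v ∈ E.weightSpace htriv μ y := by
  obtain rfl : x = y := (htriv t x).symm.trans h
  rw [hv t]
  exact Submodule.smul_mem _ _ hv

/-- The subspace of the fibre on which `T` acts trivially. -/
def fixedSpace (E : TBundle T X) (htriv : ∀ (t : T) (x : X), t • x = x) (x : X) :
    Submodule ℂ (E.fib x) where
  carrier := {v | ∀ t : T, E.act t (htriv t x) v = v}
  add_mem' {a b} ha hb t := by rw [map_add, ha t, hb t]
  zero_mem' t := map_zero _
  smul_mem' c v hv t := by rw [map_smul, hv t]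

theorem weightSpace_one (E : TBundle T X) (htriv : ∀ (t : T) (x : X), t • x = x) (x : X) :
    E.weightSpace htriv 1 x = E.fixedSpace htriv x := by
  ext v
  refine forall_congr' fun t => ?_
  have : (((1 : T →ₜ* Circle) t : Circle) : ℂ) = 1 := rfl
  rw [this, one_smul]

theorem act_mem_fixedSpace (E : TBundle T X) (htriv : ∀ (t : T) (x : X), t • x = x) (t : T)
    {x y : X} (h : t • x = y) :
    E.fixedSpace htriv x ≤ (E.fixedSpace htriv y).comap (E.act t h) := by
  intro v hv
  obtain rfl : x = y := (htriv t x).symm.trans h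
  change E.act t h v ∈ E.fixedSpace htriv x
  rwa [hv t]

variable [IsTopologicalGroup T] [CompactSpace T]

/-- Averaging against a character gives a continuous family of projections onto the weight
spaces. -/
theorem exists_projection (E : TBundle T X) (htriv : ∀ (t : T) (x : X), t • x = x)
    (μ : T →ₜ* Circle) :
    ∃ P : ∀ x, E.fib x →ₗ[ℂ] E.fib x, IsContFam E.toVBundle E.toVBundle id id P ∧
      (∀ x v, P x v ∈ E.weightSpace htriv μ x) ∧
      ∀ x, ∀ v ∈ E.weightSpace htriv μ x, P x v = v := by
  classical
  let _ : MeasurableSpace T := borel T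
  have : BorelSpace T := ⟨rfl⟩
  let m : MeasureTheory.Measure T := MeasureTheory.Measure.haarMeasure ⊤
  have hm : m Set.univ = 1 := MeasureTheory.Measure.haarMeasure_self (K₀ := ⊤)
  have : MeasureTheory.IsProbabilityMeasure m := ⟨hm⟩
  let χ : T → ℂ := fun t => ((μ t)⁻¹ : Circle)
  have hχ : Continuous χ := by
    have h : Continuous fun t => (μ t)⁻¹ := μ.continuous_toFun.inv
    exact continuous_subtype_val.comp h
  have hχ' : ∀ t, χ t * (μ t : ℂ) = 1 := fun t => by
    simp [χ]
  let _ : ∀ x, Fintype (E.idx x) := fun x => Fintype.ofFinite _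
  let b : ∀ x, Basis (E.idx x) ℂ (E.fib x) := fun x => E.frame x x (E.mem_nhd x)
  have hact := E.continuous_act_of_trivial htriv
  have hcoord : ∀ x (v : E.fib x) k,
      Continuous fun t : T => (b x).repr (E.act t (htriv t x) v) k := by
    intro x v k
    have h : ∀ t, (b x).repr (E.act t (htriv t x) v) k =
        ∑ l, (b x).repr v l * (b x).repr (E.act t (htriv t x) (b x l)) k := by
      intro t
      conv_lhs => rw [← (b x).sum_repr v]
      simp only [map_sum, map_smul, Finsupp.finsetSum_apply, Finsupp.smul_apply, smul_eq_mul]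
    simp only [h]
    refine continuous_finsetSum _ fun l _ => continuous_const.mul ?_
    exact (hact x x l k).comp
      (f := fun t : T => (⟨(t, x), E.mem_nhd x, E.mem_nhd x⟩ :
        {p : T × X // p.2 ∈ E.nhd x ∧ p.2 ∈ E.nhd x})) (by fun_prop)
  have hint : ∀ f : T → ℂ, Continuous f → MeasureTheory.Integrable f m := fun f hf =>
    (MeasureTheory.integrable_const ‖(⟨f, hf⟩ : C(T, ℂ))‖).mono' hf.aestronglyMeasurable
      (Filter.Eventually.of_forall fun t => (⟨f, hf⟩ : C(T, ℂ)).norm_coe_le_norm t)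
  have hI : ∀ x v k, MeasureTheory.Integrable
      (fun t => χ t * (b x).repr (E.act t (htriv t x) v) k) m :=
    fun x v k => hint _ (hχ.mul (hcoord x v k))
  let P : ∀ x, E.fib x →ₗ[ℂ] E.fib x := fun x =>
    { toFun := fun v =>
        ∑ k, (∫ t, χ t * (b x).repr (E.act t (htriv t x) v) k ∂m) • b x k
      map_add' := fun v w => by
        rw [← Finset.sum_add_distrib]
        refine Finset.sum_congr rfl fun k _ => ?_
        rw [← add_smul, ← MeasureTheory.integral_add (hI x v k) (hI x w k)]
        simp only [map_add, Finsupp.add_apply, mul_add]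
      map_smul' := fun c v => by
        rw [RingHom.id_apply, Finset.smul_sum]
        refine Finset.sum_congr rfl fun k _ => ?_
        rw [smul_smul, ← MeasureTheory.integral_const_mul]
        simp only [map_smul, Finsupp.smul_apply, smul_eq_mul, mul_left_comm] }
  have hφ : ∀ x (φ : E.fib x →ₗ[ℂ] ℂ) v,
      φ (P x v) = ∫ t, χ t * φ (E.act t (htriv t x) v) ∂m := by
    intro x φ v
    have h : ∀ t, χ t * φ (E.act t (htriv t x) v) =
        ∑ k, (χ t * (b x).repr (E.act t (htriv t x) v) k) * φ (b x k) := by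
      intro t
      conv_lhs => rw [← (b x).sum_repr (E.act t (htriv t x) v)]
      simp only [map_sum, map_smul, smul_eq_mul, Finset.mul_sum, mul_assoc]
    simp only [h]
    rw [MeasureTheory.integral_finsetSum _ fun k _ => (hI x v k).mul_const _]
    simp only [MeasureTheory.integral_mul_const]
    change φ (∑ k, _) = _
    simp only [map_sum, map_smul, smul_eq_mul]
  have hsep : ∀ x (v w : E.fib x), (∀ φ : E.fib x →ₗ[ℂ] ℂ, φ v = φ w) → v = w := fun x v w h =>
    (b x).ext_elem fun k => h ((b x).coord k)
  refine ⟨P, ?_, ?_, ?_⟩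
  · intro x₀ x₁ j k
    have h : ∀ z : {z : X // z ∈ E.nhd x₀ ∧ z ∈ E.nhd x₁},
        (E.frame x₁ z.1 z.2.2).repr (P z.1 (E.frame x₀ z.1 z.2.1 j)) k =
        ∫ t, χ t * (E.frame x₁ z.1 z.2.2).repr
          (E.act t (htriv t z.1) (E.frame x₀ z.1 z.2.1 j)) k ∂m :=
      fun z => hφ z.1 ((E.frame x₁ z.1 z.2.2).coord k) _
    refine Continuous.congr ?_ fun z => (h z).symm
    refine continuous_integral_of_compact m
      (fun q : {z : X // z ∈ E.nhd x₀ ∧ z ∈ E.nhd x₁} × T => χ q.2 *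
        (E.frame x₁ q.1.1 q.1.2.2).repr
          (E.act q.2 (htriv q.2 q.1.1) (E.frame x₀ q.1.1 q.1.2.1 j)) k) ?_
    refine (hχ.comp continuous_snd).mul ?_
    exact (hact x₀ x₁ j k).comp
      (f := fun q : {z : X // z ∈ E.nhd x₀ ∧ z ∈ E.nhd x₁} × T =>
        (⟨(q.2, q.1.1), q.1.2.1, q.1.2.2⟩ :
          {p : T × X // p.2 ∈ E.nhd x₀ ∧ p.2 ∈ E.nhd x₁})) (by fun_prop)
  · intro x v s
    refine hsep x _ _ fun φ => ?_
    have h₁ := hφ x (φ ∘ₗ E.act s (htriv s x)) v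
    have h₂ := hφ x φ v
    simp only [LinearMap.comp_apply] at h₁
    rw [h₁, map_smul, h₂, smul_eq_mul, ← MeasureTheory.integral_const_mul,
      ← MeasureTheory.integral_mul_left_eq_self (μ := m)
        (fun t => (μ s : ℂ) * (χ t * φ (E.act t (htriv t x) v))) s]
    refine MeasureTheory.integral_congr_ae (Filter.Eventually.of_forall fun t => ?_)
    have e : E.act (s * t) (htriv (s * t) x) v =
        E.act s (htriv s x) (E.act t (htriv t x) v) := E.act_mul s t x x x _ _ _ v
    have hc : (μ s : ℂ) * χ (s * t) = χ t := by
      simp only [χ, map_mul, mul_inv_rev, Circle.coe_mul, Circle.coe_inv]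
      field_simp
    change χ t * φ (E.act s (htriv s x) (E.act t (htriv t x) v)) =
      (μ s : ℂ) * (χ (s * t) * φ (E.act (s * t) (htriv (s * t) x) v))
    rw [e, ← mul_assoc, hc]
  · intro x v hv
    refine hsep x _ _ fun φ => ?_
    have hv' : ∀ t, χ t * φ (E.act t (htriv t x) v) = φ v := by
      intro t
      rw [hv t, map_smul, smul_eq_mul, ← mul_assoc]
      rw [hχ', one_mul]
    rw [hφ]
    simp [hv']

/-- The idempotents exhibiting the weight spaces as a retract. -/
def weightRetract (E : TBundle T X) (htriv : ∀ (t : T) (x : X), t • x = x) (μ : T →ₜ* Circle) :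
    Retract E.toVBundle :=
  let P := (E.exists_projection htriv μ).choose
  have hP := (E.exists_projection htriv μ).choose_spec
  { Q := fun x => E.weightSpace htriv μ x
    i := fun x => (E.weightSpace htriv μ x).subtype
    r := fun x => (P x).codRestrict _ (hP.2.1 x)
    r_i := fun x v => Subtype.ext (hP.2.2 x v.1 v.2)
    continuous_i_r := hP.1 }

/-- The isotypic subbundle `E_μ` of an equivariant bundle over a space on which `T` acts
trivially: its fibres are the subspaces on which `T` acts with weight `μ`. -/
def isotypic (E : TBundle T X) (htriv : ∀ (t : T) (x : X), t • x = x) (μ : T →ₜ* Circle) :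
    TBundle T X where
  toVBundle := (E.weightRetract htriv μ).bundle
  act t _ _ h := (E.act t h).restrict (E.act_mem_weightSpace htriv μ t h)
  act_one x h v := Subtype.ext (E.act_one x h v.1)
  act_mul s t x y z h₁ h₂ h₃ v := Subtype.ext (E.act_mul s t x y z h₁ h₂ h₃ v.1)
  continuous_act := by
    have h₁ := (E.weightRetract htriv μ).continuous_i.param (continuous_snd (X := T))
    have h₂ := E.continuous_act.comp h₁ continuous_snd
    have h₃ := (E.weightRetract htriv μ).continuous_r.param (E.continuous_proj_smul htriv)
    refine IsContFam.congr (h₃.comp h₂ (E.continuous_proj_smul htriv)) fun p => ?_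
    refine LinearMap.ext fun v => ?_
    exact (E.weightRetract htriv μ).r_i (p.1 • p.2)
      ((E.act p.1 rfl).restrict (E.act_mem_weightSpace htriv μ p.1 rfl) v)

/-- The idempotents exhibiting the quotients by the fixed subspaces as a retract. -/
def quotRetract (E : TBundle T X) (htriv : ∀ (t : T) (x : X), t • x = x) :
    Retract E.toVBundle :=
  let P := (E.exists_projection htriv 1).choose
  have hP := (E.exists_projection htriv 1).choose_spec
  { Q := fun x => E.fib x ⧸ E.fixedSpace htriv x
    i := fun x => (E.fixedSpace htriv x).liftQ (LinearMap.id + (-1 : ℂ) • P x) fun v hv => by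
      rw [← weightSpace_one] at hv
      simp [hP.2.2 x v hv, P]
    r := fun x => (E.fixedSpace htriv x).mkQ
    r_i := fun x v => by
      obtain ⟨v, rfl⟩ := Submodule.mkQ_surjective _ v
      have h := hP.2.1 x v
      rw [weightSpace_one] at h
      simpa [Submodule.Quotient.mk_eq_zero] using h
    continuous_i_r := IsContFam.congr ((isContFam_id E.toVBundle).add (hP.1.smul (-1)))
      fun _ => LinearMap.ext fun _ => rfl }

/-- The quotient `E / E^T` of an equivariant bundle over a space on which `T` acts trivially by
the subbundle of fixed vectors. -/
def modFixed (E : TBundle T X) (htriv : ∀ (t : T) (x : X), t • x = x) : TBundle T X where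
  toVBundle := (E.quotRetract htriv).bundle
  act t _ _ h := Submodule.mapQ _ _ (E.act t h) (E.act_mem_fixedSpace htriv t h)
  act_one x h v := by
    obtain ⟨v, rfl⟩ := Submodule.mkQ_surjective (E.fixedSpace htriv x) v
    exact congrArg _ (E.act_one x h v)
  act_mul s t x y z h₁ h₂ h₃ v := by
    obtain ⟨v, rfl⟩ := Submodule.mkQ_surjective (E.fixedSpace htriv x) v
    exact congrArg _ (E.act_mul s t x y z h₁ h₂ h₃ v)
  continuous_act := by
    have h₁ := (E.quotRetract htriv).continuous_i.param (continuous_snd (X := T))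
    have h₂ := E.continuous_act.comp h₁ continuous_snd
    have h₃ := (E.quotRetract htriv).continuous_r.param (E.continuous_proj_smul htriv)
    refine IsContFam.congr (h₃.comp h₂ (E.continuous_proj_smul htriv)) fun p => ?_
    refine LinearMap.ext fun v => ?_
    have h := (E.quotRetract htriv).r_i p.2 v
    have e : Submodule.mapQ _ _ (E.act p.1 rfl) (E.act_mem_fixedSpace htriv p.1 rfl)
        ((E.quotRetract htriv).r p.2 ((E.quotRetract htriv).i p.2 v)) =
        (E.quotRetract htriv).r (p.1 • p.2)
          (E.act p.1 rfl ((E.quotRetract htriv).i p.2 v)) := rfl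
    rw [h] at e
    exact e.symm

end TBundle

/-! ### Stably complex manifolds with a group action -/

section Manifold

variable {T : Type v} {M : Type u} [CommGroup T] [MulAction T M]

/-- The action `t_* : T_p M → T_q M` on tangent spaces, where `t • p = q`. -/
def push (n : ℕ) [TopologicalSpace M] [ChartedSpace (EuclideanSpace ℝ (Fin n)) M] (t : T)
    {p q : M} (h : t • p = q) :
    TangentSpace (𝓡 n) p →L[ℝ] TangentSpace (𝓡 n) q :=
  h ▸ mfderiv (𝓡 n) (𝓡 n) (fun x : M => t • x) p

/-- A stable (almost) complex structure on a `T`-manifold `M` of dimension `n`: a smooth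
`T`-equivariant complex structure `J` on the fibres of `TM ⊕ τ`, where `τ` is a product bundle
`M × ℝᵏ` with the trivial action on `ℝᵏ`. The total space of `TM ⊕ τ` is `TM × ℝᵏ`. -/
structure StableComplexStructure (n : ℕ) (T : Type v) (M : Type u) [CommGroup T]
    [TopologicalSpace M] [ChartedSpace (EuclideanSpace ℝ (Fin n)) M] [IsManifold (𝓡 n) ∞ M]
    [MulAction T M] where
  k : ℕ
  J : ∀ p : M, (TangentSpace (𝓡 n) p × EuclideanSpace ℝ (Fin k)) →ₗ[ℝ]
    (TangentSpace (𝓡 n) p × EuclideanSpace ℝ (Fin k))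
  J_J : ∀ p v, J p (J p v) = -v
  smooth_J : ContMDiff ((𝓡 n).tangent.prod 𝓘(ℝ, EuclideanSpace ℝ (Fin k)))
    ((𝓡 n).tangent.prod 𝓘(ℝ, EuclideanSpace ℝ (Fin k))) ∞
    (fun ξ : TangentBundle (𝓡 n) M × EuclideanSpace ℝ (Fin k) =>
      ((⟨ξ.1.proj, (J ξ.1.proj (ξ.1.snd, ξ.2)).1⟩, (J ξ.1.proj (ξ.1.snd, ξ.2)).2) :
        TangentBundle (𝓡 n) M × EuclideanSpace ℝ (Fin k)))
  equivariant_J : ∀ (t : T) (p q : M) (h : t • p = q) v,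
    J q (push n t h v.1, v.2) = (push n t h (J p v).1, (J p v).2)

/-- The fixed point set `M^T`. -/
def FixedSet (T : Type v) (M : Type u) [CommGroup T] [MulAction T M] : Type u :=
  {x : M // ∀ t : T, t • x = x}

namespace FixedSet

instance : MulAction T (FixedSet T M) where
  smul t x := ⟨t • x.1, fun s => by rw [x.2 t, x.2 s]⟩
  one_smul x := Subtype.ext (one_smul T x.1)
  mul_smul s t x := Subtype.ext (mul_smul s t x.1)

theorem smul_eq (t : T) (x : FixedSet T M) : t • x = x := Subtype.ext (x.2 t)

theorem coe_smul (t : T) (x : FixedSet T M) : (t • x).1 = t • x.1 := rfl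

variable [TopologicalSpace M]

instance : TopologicalSpace (FixedSet T M) := instTopologicalSpaceSubtype

theorem continuous_val : Continuous fun x : FixedSet T M => x.1 := continuous_subtype_val

/-- A connected component `W` of `M^T`, as a space. -/
def Component (W : ConnectedComponents (FixedSet T M)) : Type u :=
  {x : FixedSet T M // ConnectedComponents.mk x = W}

instance (W : ConnectedComponents (FixedSet T M)) : TopologicalSpace (Component W) :=
  instTopologicalSpaceSubtype

instance (W : ConnectedComponents (FixedSet T M)) : MulAction T (Component W) where
  smul t x := ⟨t • x.1, by rw [smul_eq, x.2]⟩
  one_smul x := Subtype.ext (one_smul T x.1)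
  mul_smul s t x := Subtype.ext (mul_smul s t x.1)

theorem Component.smul_eq {W : ConnectedComponents (FixedSet T M)} (t : T) (x : Component W) :
    t • x = x := Subtype.ext (FixedSet.smul_eq t x.1)

instance [TopologicalSpace T] (W : ConnectedComponents (FixedSet T M)) :
    ContinuousSMul T (Component W) where
  continuous_smul := by
    simp only [Component.smul_eq]
    exact continuous_snd

end FixedSet

section Push

variable {n : ℕ} [TopologicalSpace M] [ChartedSpace (EuclideanSpace ℝ (Fin n)) M]

theorem push_eq (t : T) {p q : M} (h : t • p = q) (v : TangentSpace (𝓡 n) p) :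
    (push n t h v : EuclideanSpace ℝ (Fin n)) =
      mfderiv (𝓡 n) (𝓡 n) (fun x : M => t • x) p v := by
  subst h
  rfl

theorem push_one (p : M) (h : (1 : T) • p = p) (v : TangentSpace (𝓡 n) p) : push n 1 h v = v := by
  have key : ∀ f : M → M, f = id →
      (mfderiv (𝓡 n) (𝓡 n) f p v : EuclideanSpace ℝ (Fin n)) = v := by
    rintro f rfl
    rw [mfderiv_id]
    rfl
  exact (push_eq 1 h v).trans (key _ (funext fun x => one_smul T x))

variable [TopologicalSpace T]

theorem mdifferentiable_smul (d : ℕ) [ChartedSpace (EuclideanSpace ℝ (Fin d)) T]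
    [ContMDiffSMul (𝓡 d) (𝓡 n) ∞ T M] (t : T) :
    MDifferentiable (𝓡 n) (𝓡 n) (fun x : M => t • x) := by
  have h : ContMDiff (𝓡 n) (𝓡 n) ∞ (fun x : M => t • x) :=
    (ContMDiffSMul.contMDiff_smul (I := 𝓡 d) (I' := 𝓡 n) (n := ∞) (G := T) (M := M)).comp
      (contMDiff_const.prodMk contMDiff_id)
  exact h.mdifferentiable (by simp)

theorem push_mul (d : ℕ) [ChartedSpace (EuclideanSpace ℝ (Fin d)) T]
    [ContMDiffSMul (𝓡 d) (𝓡 n) ∞ T M] (s t : T) {p q r : M} (h₁ : t • p = q) (h₂ : s • q = r)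
    (h₃ : (s * t) • p = r) (v : TangentSpace (𝓡 n) p) :
    push n (s * t) h₃ v = push n s h₂ (push n t h₁ v) := by
  subst h₁
  have key : ∀ f : M → M, f = (fun x : M => s • x) ∘ (fun x : M => t • x) →
      (mfderiv (𝓡 n) (𝓡 n) f p v : EuclideanSpace ℝ (Fin n)) =
        mfderiv (𝓡 n) (𝓡 n) (fun x : M => s • x) (t • p)
          (mfderiv (𝓡 n) (𝓡 n) (fun x : M => t • x) p v) := by
    rintro f rfl
    rw [mfderiv_comp p (mdifferentiable_smul d s (t • p)) (mdifferentiable_smul d t p)]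
    rfl
  refine (push_eq (s * t) h₃ v).trans ((key _ (funext fun x => mul_smul s t x)).trans ?_)
  exact (push_eq s h₂ _).symm

theorem continuous_push [IsManifold (𝓡 n) ∞ M] (d : ℕ) [ChartedSpace (EuclideanSpace ℝ (Fin d)) T]
    [LieGroup (𝓡 d) ∞ T] [ContMDiffSMul (𝓡 d) (𝓡 n) ∞ T M] :
    Continuous fun q : T × TangentBundle (𝓡 n) M =>
      (⟨q.1 • q.2.proj, push n q.1 rfl q.2.snd⟩ : TangentBundle (𝓡 n) M) := by
  have hA : ContMDiff ((𝓡 d).prod (𝓡 n)) (𝓡 n) ∞ (fun q : T × M => q.1 • q.2) :=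
    ContMDiffSMul.contMDiff_smul
  have hT : Continuous (tangentMap ((𝓡 d).prod (𝓡 n)) (𝓡 n) (fun q : T × M => q.1 • q.2)) :=
    hA.continuous_tangentMap (by simp)
  have h₀ : Continuous fun t : T => (⟨t, 0⟩ : TangentBundle (𝓡 d) T) :=
    Bundle.Trivialization.continuous_zeroSection (F := EuclideanSpace ℝ (Fin d))
      (E := (TangentSpace (𝓡 d) : T → Type)) ℝ
  have h₁ : Continuous fun q : T × TangentBundle (𝓡 n) M =>
      (equivTangentBundleProd (𝓡 d) T (𝓡 n) M).symm
        ((⟨q.1, 0⟩ : TangentBundle (𝓡 d) T), q.2) :=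
    (contMDiff_equivTangentBundleProd_symm (n := 0)).continuous.comp
      ((h₀.comp continuous_fst).prodMk continuous_snd)
  refine (hT.comp h₁).congr fun q => ?_
  have hd : mfderiv (𝓡 n) (𝓡 n) (fun x : M => q.1 • x) q.2.proj q.2.snd =
      mfderiv ((𝓡 d).prod (𝓡 n)) (𝓡 n) (fun q : T × M => q.1 • q.2) (q.1, q.2.proj)
        (0, q.2.snd) := by
    have hc : (fun x : M => q.1 • x) = (fun q : T × M => q.1 • q.2) ∘ fun x : M => (q.1, x) := rfl
    rw [hc, mfderiv_comp q.2.proj (hA.mdifferentiable (by simp) _)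
      ((contMDiff_const.prodMk contMDiff_id : ContMDiff (𝓡 n) ((𝓡 d).prod (𝓡 n)) ∞
        (fun x : M => (q.1, x))).mdifferentiable (by simp) _), mfderiv_prod_right]
    rfl
  exact congrArg (fun u => (⟨q.1 • q.2.proj, u⟩ : TangentBundle (𝓡 n) M)) hd.symm

end Push

end Manifold

/-! ### The stable tangent bundle as an equivariant complex vector bundle -/

section StableTangent

variable {M : Type u} [TopologicalSpace M] {n : ℕ} [ChartedSpace (EuclideanSpace ℝ (Fin n)) M]
  [IsManifold (𝓡 n) ∞ M]

/-- The fibre of `TM ⊕ τ` at `p`, as a real vector space. -/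
abbrev RFib (n k : ℕ) {M : Type u} [TopologicalSpace M] [ChartedSpace (EuclideanSpace ℝ (Fin n)) M]
    (p : M) : Type :=
  TangentSpace (𝓡 n) p × EuclideanSpace ℝ (Fin k)

/-- The trivialization of the tangent bundle given by the preferred chart at `p₀`. -/
abbrev triv (n : ℕ) {M : Type u} [TopologicalSpace M] [ChartedSpace (EuclideanSpace ℝ (Fin n)) M]
    [IsManifold (𝓡 n) ∞ M] (p₀ : M) :
    Bundle.Trivialization (EuclideanSpace ℝ (Fin n))
      (Bundle.TotalSpace.proj : TangentBundle (𝓡 n) M → M) :=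
  haveI : IsManifold (𝓡 n) 1 M := IsManifold.of_le (n := ∞) (by simp)
  trivializationAt (EuclideanSpace ℝ (Fin n)) (TangentSpace (𝓡 n)) p₀

/-- The local frame of `TM ⊕ τ` over the chart at `p₀`. -/
def realFrame (k : ℕ) (p₀ p : M) (h : p ∈ (triv n p₀).baseSet) :
    Basis (Fin n ⊕ Fin k) ℝ (RFib n k p) :=
  haveI : IsManifold (𝓡 n) 1 M := IsManifold.of_le (n := ∞) (by simp)
  ((EuclideanSpace.basisFun (Fin n) ℝ).toBasis.map
    ((triv n p₀).continuousLinearEquivAt ℝ p h).symm.toLinearEquiv).prod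
    (EuclideanSpace.basisFun (Fin k) ℝ).toBasis

theorem continuous_realFrame (k : ℕ) (p₀ : M) (j : Fin n ⊕ Fin k) :
    Continuous fun p : {p : M // p ∈ (triv n p₀).baseSet} =>
      ((⟨p.1, (realFrame k p₀ p.1 p.2 j).1⟩, (realFrame k p₀ p.1 p.2 j).2) :
        TangentBundle (𝓡 n) M × EuclideanSpace ℝ (Fin k)) := by
  have : IsManifold (𝓡 n) 1 M := IsManifold.of_le (n := ∞) (by simp)
  have hc : ∀ u : EuclideanSpace ℝ (Fin n),
      Continuous fun p : {p : M // p ∈ (triv n p₀).baseSet} =>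
        (⟨p.1, ((triv n p₀).continuousLinearEquivAt ℝ p.1 p.2).symm u⟩ :
          TangentBundle (𝓡 n) M) := by
    intro u
    have h := (triv n p₀).continuousOn_symm.comp_continuous
      (f := fun p : {p : M // p ∈ (triv n p₀).baseSet} => (p.1, u)) (by fun_prop)
      fun p => ⟨p.2, trivial⟩
    exact h.congr fun p => rfl
  rcases j with j | j
  · refine Continuous.prodMk ?_ ?_
    · refine (hc ((EuclideanSpace.basisFun (Fin n) ℝ).toBasis j)).congr fun p => ?_
      simp [realFrame]
    · simp only [realFrame, Basis.prod_apply_inl_snd]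
      exact continuous_const
  · refine Continuous.prodMk ?_ ?_
    · refine (hc 0).congr fun p => ?_
      simp only [realFrame, Basis.prod_apply_inr_fst, map_zero]
    · simp only [realFrame, Basis.prod_apply_inr_snd]
      exact continuous_const

theorem continuous_realFrame_repr (k : ℕ) (p₁ : M) {Z : Type*} [TopologicalSpace Z] (b : Z → M)
    (hb : ∀ z, b z ∈ (triv n p₁).baseSet) (w : ∀ z, RFib n k (b z))
    (hw : Continuous fun z => ((⟨b z, (w z).1⟩, (w z).2) :
        TangentBundle (𝓡 n) M × EuclideanSpace ℝ (Fin k))) (i : Fin n ⊕ Fin k) :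
    Continuous fun z => (realFrame k p₁ (b z) (hb z)).repr (w z) i := by
  have : IsManifold (𝓡 n) 1 M := IsManifold.of_le (n := ∞) (by simp)
  rcases i with i | i
  · have h := (triv n p₁).continuousOn.comp_continuous hw.fst
      fun z => (triv n p₁).mem_source.2 (hb z)
    have h' : Continuous fun z => ((triv n p₁) ⟨b z, (w z).1⟩).2 i :=
      (by fun_prop : Continuous fun u : EuclideanSpace ℝ (Fin n) => u i).comp h.snd
    refine h'.congr fun z => ?_
    simp [realFrame, Basis.prod_repr_inl]
  · have h' : Continuous fun z => (w z).2 i :=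
      (by fun_prop : Continuous fun u : EuclideanSpace ℝ (Fin k) => u i).comp hw.snd
    refine h'.congr fun z => ?_
    simp [realFrame, Basis.prod_repr_inr]

theorem continuous_baseChange (k : ℕ) {Z : Type*} [TopologicalSpace Z] {a b : Z → M}
    (φ : ∀ z, RFib n k (a z) →ₗ[ℝ] RFib n k (b z))
    (hφ : ∀ p₀ j, Continuous fun z : {z : Z // a z ∈ (triv n p₀).baseSet} =>
      ((⟨b z.1, (φ z.1 (realFrame k p₀ (a z.1) z.2 j)).1⟩,
        (φ z.1 (realFrame k p₀ (a z.1) z.2 j)).2) :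
        TangentBundle (𝓡 n) M × EuclideanSpace ℝ (Fin k))) (p₀ p₁ : M) (j i) :
    Continuous fun z : {z : Z // a z ∈ (triv n p₀).baseSet ∧ b z ∈ (triv n p₁).baseSet} =>
      ((realFrame k p₁ (b z.1) z.2.2).baseChange ℂ).repr
        ((φ z.1).baseChange ℂ ((realFrame k p₀ (a z.1) z.2.1).baseChange ℂ j)) i := by
  simp only [Basis.baseChange_apply, LinearMap.baseChange_tmul, Basis.baseChange_repr_tmul]
  simp only [Algebra.smul_def, mul_one]
  refine Complex.continuous_ofReal.comp ?_
  refine continuous_realFrame_repr k p₁ _ _ _ ?_ i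
  exact (hφ p₀ j).comp
    (f := fun z : {z : Z // a z ∈ (triv n p₀).baseSet ∧ b z ∈ (triv n p₁).baseSet} =>
      (⟨z.1, z.2.1⟩ : {z : Z // a z ∈ (triv n p₀).baseSet}))
    (continuous_subtype_val.subtype_mk _)

/-- The complexification of `TM ⊕ τ`. -/
def complexified (n k : ℕ) (M : Type u) [TopologicalSpace M]
    [ChartedSpace (EuclideanSpace ℝ (Fin n)) M] [IsManifold (𝓡 n) ∞ M] : VBundle M where
  fib p := ℂ ⊗[ℝ] RFib n k p
  nhd p := (triv n p).baseSet
  isOpen_nhd p := (triv n p).open_baseSet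
  mem_nhd p := FiberBundle.mem_baseSet_trivializationAt' p
  idx _ := Fin n ⊕ Fin k
  frame p₀ p h := (realFrame k p₀ p h).baseChange ℂ
  continuous_transition p₀ p₁ j i := by
    simpa using continuous_baseChange k (a := id) (b := id) (fun p => LinearMap.id)
      (fun p₀ j => continuous_realFrame k p₀ j) p₀ p₁ j i

theorem isContFam_baseChange (k : ℕ) {Z : Type*} [TopologicalSpace Z] {a b : Z → M}
    (φ : ∀ z, RFib n k (a z) →ₗ[ℝ] RFib n k (b z))
    (hφ : ∀ p₀ j, Continuous fun z : {z : Z // a z ∈ (triv n p₀).baseSet} =>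
      ((⟨b z.1, (φ z.1 (realFrame k p₀ (a z.1) z.2 j)).1⟩,
        (φ z.1 (realFrame k p₀ (a z.1) z.2 j)).2) :
        TangentBundle (𝓡 n) M × EuclideanSpace ℝ (Fin k))) :
    IsContFam (complexified n k M) (complexified n k M) a b fun z => (φ z).baseChange ℂ :=
  fun p₀ p₁ j i => continuous_baseChange k φ hφ p₀ p₁ j i

end StableTangent

namespace StableComplexStructure

variable {n : ℕ} {T : Type v} {M : Type u} [CommGroup T] [TopologicalSpace M]
  [ChartedSpace (EuclideanSpace ℝ (Fin n)) M] [IsManifold (𝓡 n) ∞ M] [MulAction T M]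
  (S : StableComplexStructure n T M)

/-- The fibre of `TM ⊕ τ` at `p`. -/
def Fib (p : M) : Type := RFib n S.k p

instance (p : M) : AddCommGroup (S.Fib p) := inferInstanceAs (AddCommGroup (RFib n S.k p))

instance (p : M) : Module ℝ (S.Fib p) := inferInstanceAs (Module ℝ (RFib n S.k p))

/-- The complex structure of a fibre, as an endomorphism. -/
def jEnd (p : M) : Module.End ℝ (S.Fib p) := S.J p

theorem jEnd_jEnd (p : M) (v : S.Fib p) : S.jEnd p (S.jEnd p v) = -v := S.J_J p v

/-- The complex vector space structure of the fibres of `TM ⊕ τ`, in which `i` acts as `J`. -/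
instance (p : M) : Module ℂ (S.Fib p) :=
  Module.compHom _ (Complex.lift ⟨S.jEnd p, LinearMap.ext fun v => S.jEnd_jEnd p v⟩ :
    ℂ →ₐ[ℝ] Module.End ℝ (S.Fib p)).toRingHom

theorem smul_def (p : M) (z : ℂ) (v : S.Fib p) : z • v = z.re • v + z.im • S.jEnd p v := rfl

instance (p : M) : IsScalarTower ℝ ℂ (S.Fib p) where
  smul_assoc a z v := by
    have h : (a • z).re • v + (a • z).im • S.jEnd p v =
        a • (z.re • v + z.im • S.jEnd p v) := by
      rw [Complex.smul_re, Complex.smul_im, smul_eq_mul, smul_eq_mul, mul_smul, mul_smul,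
        ← smul_add]
    exact h

theorem I_smul (p : M) (v : S.Fib p) : Complex.I • v = S.jEnd p v := by
  simp [smul_def]

/-- A real linear map between fibres that commutes with `J` is complex linear. -/
def ofReal {p q : M} (φ : RFib n S.k p →ₗ[ℝ] RFib n S.k q)
    (hφ : ∀ v, S.J q (φ v) = φ (S.J p v)) : S.Fib p →ₗ[ℂ] S.Fib q where
  toFun v := φ v
  map_add' v w := map_add φ v w
  map_smul' z v := by
    have h₁ : ∀ v : RFib n S.k p, φ (z.re • v + z.im • S.J p v) =
        z.re • φ v + z.im • S.J q (φ v) := fun v => by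
      rw [map_add, map_smul, map_smul, hφ v]
    exact h₁ v

/-- `v ↦ (1 ⊗ v - i ⊗ J v) / 2`. -/
def incl (p : M) : S.Fib p →ₗ[ℂ] ℂ ⊗[ℝ] S.Fib p where
  toFun v := (1 / 2 : ℂ) • ((1 : ℂ) ⊗ₜ[ℝ] v - Complex.I ⊗ₜ[ℝ] S.jEnd p v)
  map_add' v w := by
    rw [← smul_add, map_add, TensorProduct.tmul_add, TensorProduct.tmul_add]
    congr 1
    abel
  map_smul' z v := by
    rw [RingHom.id_apply, smul_comm z]
    congr 1
    have h₁ : z = ((z.re : ℝ) : ℂ) + ((z.im : ℝ) : ℂ) * Complex.I := (Complex.re_add_im z).symm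
    rw [smul_def, map_add, map_smul, map_smul, jEnd_jEnd, TensorProduct.tmul_add,
      TensorProduct.tmul_add, TensorProduct.tmul_smul, TensorProduct.tmul_smul,
      TensorProduct.tmul_smul, TensorProduct.tmul_smul, TensorProduct.tmul_neg]
    simp only [TensorProduct.smul_tmul', smul_sub, ← TensorProduct.neg_tmul]
    have e₁ : z • (1 : ℂ) = z.re • (1 : ℂ) + z.im • Complex.I := by
      simp
    have e₂ : z • Complex.I = z.re • Complex.I + - (z.im • (1 : ℂ)) := by
      simp only [smul_eq_mul, Complex.real_smul]
      conv_lhs => rw [h₁, add_mul, mul_assoc, Complex.I_mul_I]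
      ring
    rw [e₁, e₂, TensorProduct.add_tmul, TensorProduct.add_tmul, TensorProduct.neg_tmul, smul_neg,
      TensorProduct.neg_tmul]
    abel

/-- `z ⊗ v ↦ z v`. -/
def retr (p : M) : ℂ ⊗[ℝ] S.Fib p →ₗ[ℂ] S.Fib p :=
  LinearMap.liftBaseChange ℂ LinearMap.id

theorem retr_incl (p : M) (v : S.Fib p) : S.retr p (S.incl p v) = v := by
  have h : S.incl p v = (1 / 2 : ℂ) • ((1 : ℂ) ⊗ₜ[ℝ] v - Complex.I ⊗ₜ[ℝ] S.jEnd p v) := rfl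
  rw [h, map_smul, map_sub]
  simp only [retr, LinearMap.liftBaseChange_tmul, LinearMap.id_apply, one_smul, I_smul, jEnd_jEnd,
    sub_neg_eq_add]
  rw [← two_smul ℂ v, smul_smul]
  norm_num

theorem incl_retr (p : M) :
    S.incl p ∘ₗ S.retr p = (1 / 2 : ℂ) • LinearMap.id +
      (-(Complex.I / 2)) • (S.jEnd p).baseChange ℂ := by
  refine TensorProduct.AlgebraTensorModule.curry_injective ?_
  refine LinearMap.ext_ring ?_
  refine LinearMap.ext fun v => ?_
  change S.incl p (S.retr p (1 ⊗ₜ v)) = (1 / 2 : ℂ) • ((1 : ℂ) ⊗ₜ[ℝ] v) +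
      (-(Complex.I / 2)) • ((S.jEnd p).baseChange ℂ (1 ⊗ₜ v))
  have h : S.incl p v = (1 / 2 : ℂ) • ((1 : ℂ) ⊗ₜ[ℝ] v - Complex.I ⊗ₜ[ℝ] S.jEnd p v) := rfl
  rw [retr, LinearMap.liftBaseChange_tmul, LinearMap.id_apply, one_smul, h,
    LinearMap.baseChange_tmul, smul_sub, sub_eq_add_neg, TensorProduct.smul_tmul',
    TensorProduct.smul_tmul', TensorProduct.smul_tmul', ← TensorProduct.neg_tmul]
  congr 2
  simp only [smul_eq_mul]
  ring

theorem continuous_J : IsContFam (complexified n S.k M) (complexified n S.k M) id id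
    fun p => (S.J p).baseChange ℂ :=
  isContFam_baseChange S.k (a := id) (b := id) S.J fun p₀ j =>
    S.smooth_J.continuous.comp (continuous_realFrame S.k p₀ j)

/-- `(TM ⊕ τ, J)` as a retract of the complexification of `TM ⊕ τ`. -/
def retract : Retract (complexified n S.k M) where
  Q := S.Fib
  i := S.incl
  r := S.retr
  r_i := S.retr_incl
  continuous_i_r := by
    have h := ((isContFam_id (complexified n S.k M)).smul (1 / 2)).add
      (S.continuous_J.smul (-(Complex.I / 2)))
    exact h.congr fun p => (S.incl_retr p).symm

theorem baseChange_incl {p q : M} (φ : S.Fib p →ₗ[ℝ] S.Fib q)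
    (hφ : ∀ v, S.J q (φ v) = φ (S.J p v)) (v : S.Fib p) :
    S.retr q (φ.baseChange ℂ (S.incl p v)) = S.ofReal φ hφ v := by
  have h : S.incl p v = (1 / 2 : ℂ) • ((1 : ℂ) ⊗ₜ[ℝ] v - Complex.I ⊗ₜ[ℝ] S.jEnd p v) := rfl
  have h' : φ.baseChange ℂ (S.incl p v) =
      S.incl q (S.ofReal φ hφ v) := by
    have e : φ (S.jEnd p v) = S.jEnd q (S.ofReal φ hφ v) := (hφ v).symm
    have h₂ : S.incl q (S.ofReal φ hφ v) = (1 / 2 : ℂ) • ((1 : ℂ) ⊗ₜ[ℝ] (S.ofReal φ hφ v) -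
      Complex.I ⊗ₜ[ℝ] S.jEnd q (S.ofReal φ hφ v)) := rfl
    have e' : φ v = S.ofReal φ hφ v := rfl
    rw [h, h₂, map_smul, map_sub, LinearMap.baseChange_tmul, LinearMap.baseChange_tmul, e, e']
  rw [h', retr_incl]

/-- The action of `t` on the fibres of `TM ⊕ τ`, trivial on the summand `τ`. -/
def pushSum (t : T) {p q : M} (h : t • p = q) : RFib n S.k p →ₗ[ℝ] RFib n S.k q :=
  (push n t h).toLinearMap.prodMap LinearMap.id

variable [TopologicalSpace T]

/-- The `T`-equivariant complex vector bundle `(TM ⊕ τ, J)`. -/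
def stableTangent (d : ℕ) [ChartedSpace (EuclideanSpace ℝ (Fin d)) T] [LieGroup (𝓡 d) ∞ T]
    [ContMDiffSMul (𝓡 d) (𝓡 n) ∞ T M] : TBundle T M where
  toVBundle := S.retract.bundle
  act t p q h := S.ofReal (S.pushSum t h) fun v => S.equivariant_J t p q h v
  act_one p h v := Prod.ext (push_one p h v.1) rfl
  act_mul s t p q r h₁ h₂ h₃ v := Prod.ext (push_mul d s t h₁ h₂ h₃ v.1) rfl
  continuous_act := by
    have hsm : Continuous fun p : T × M => p.1 • p.2 :=
      (ContMDiffSMul.contMDiff_smul (I := 𝓡 d) (I' := 𝓡 n) (n := ∞) (G := T) (M := M)).continuous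
    have h₀ : IsContFam (complexified n S.k M) (complexified n S.k M)
        (fun p : T × M => p.2) (fun p => p.1 • p.2)
        fun p => (S.pushSum p.1 rfl).baseChange ℂ := by
      refine isContFam_baseChange S.k (a := fun p : T × M => p.2) (b := fun p => p.1 • p.2)
        (fun p => S.pushSum p.1 rfl) fun p₀ j => ?_
      have hf := (continuous_realFrame S.k p₀ j).comp
        (f := fun z : {z : T × M // z.2 ∈ (triv n p₀).baseSet} =>
          (⟨z.1.2, z.2⟩ : {p : M // p ∈ (triv n p₀).baseSet})) (by fun_prop)
      have hz : Continuous fun z : {z : T × M // z.2 ∈ (triv n p₀).baseSet} => z.1.1 := by fun_prop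
      exact ((continuous_push d).comp (hz.prodMk hf.fst)).prodMk hf.snd
    have h₁ := S.retract.continuous_i.param (continuous_snd (X := T) (Y := M))
    have h₂ := h₀.comp h₁ continuous_snd
    have h₃ := S.retract.continuous_r.param hsm
    refine IsContFam.congr (h₃.comp h₂ hsm) fun p => ?_
    exact LinearMap.ext fun v => S.baseChange_incl (S.pushSum p.1 rfl) _ v

end StableComplexStructure

/-! ### The star product -/

section LogWeight

/-- The logweight `a_μ(t) ∈ [0, 1)`, characterized by `μ(t) = exp(2πi a_μ(t))`. -/
def logWeight {T : Type v} [Group T] [TopologicalSpace T] (μ : T →ₜ* Circle) (t : T) : ℝ :=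
  Int.fract (Complex.arg (μ t) / (2 * Real.pi))

variable {T : Type v} [Group T] [TopologicalSpace T] (μ : T →ₜ* Circle)

theorem logWeight_nonneg (t : T) : 0 ≤ logWeight μ t := Int.fract_nonneg _

theorem logWeight_lt_one (t : T) : logWeight μ t < 1 := Int.fract_lt_one _

theorem exp_logWeight (t : T) :
    Complex.exp (2 * Real.pi * Complex.I * logWeight μ t) = (μ t : ℂ) := by
  have h : (logWeight μ t : ℂ) = (Complex.arg (μ t) : ℂ) / (2 * Real.pi) -
      (⌊Complex.arg (μ t) / (2 * Real.pi)⌋ : ℂ) := by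
    rw [logWeight, Int.fract]
    push_cast
    rfl
  have hpi : (Real.pi : ℂ) ≠ 0 := by exact_mod_cast Real.pi_ne_zero
  have e : 2 * Real.pi * Complex.I * logWeight μ t = (Complex.arg (μ t) : ℂ) * Complex.I -
      (⌊Complex.arg (μ t) / (2 * Real.pi)⌋ : ℂ) * (2 * Real.pi * Complex.I) := by
    rw [h]
    field_simp
  rw [e, Complex.exp_sub, Complex.exp_int_mul_two_pi_mul_I, div_one]
  have hn : ‖(μ t : ℂ)‖ = 1 := Circle.norm_coe _
  have := Complex.norm_mul_exp_arg_mul_I (μ t : ℂ)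
  rwa [hn, Complex.ofReal_one, one_mul] at this

/-- The exponent `a_μ(t₁) + a_μ(t₂) - a_μ(t₁ t₂)`, which is `0` or `1`, as a natural number. -/
def twistExponent (t₁ t₂ : T) : ℕ :=
  ⌊logWeight μ t₁ + logWeight μ t₂ - logWeight μ (t₁ * t₂)⌋₊

theorem twistExponent_eq (t₁ t₂ : T) :
    (twistExponent μ t₁ t₂ : ℝ) = logWeight μ t₁ + logWeight μ t₂ - logWeight μ (t₁ * t₂) := by
  have hexp : Complex.exp
      (2 * Real.pi * Complex.I * (logWeight μ t₁ + logWeight μ t₂ - logWeight μ (t₁ * t₂))) = 1 := by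
    rw [mul_sub, mul_add, Complex.exp_sub, Complex.exp_add, exp_logWeight, exp_logWeight,
      exp_logWeight, map_mul, Circle.coe_mul]
    exact div_self (mul_ne_zero (Circle.coe_ne_zero _) (Circle.coe_ne_zero _))
  obtain ⟨m, hm⟩ := Complex.exp_eq_one_iff.1 hexp
  have hm' : logWeight μ t₁ + logWeight μ t₂ - logWeight μ (t₁ * t₂) = (m : ℝ) := by
    have h2 : (2 * Real.pi * Complex.I : ℂ) ≠ 0 := Complex.two_pi_I_ne_zero
    rw [mul_comm (m : ℂ)] at hm
    have := mul_left_cancel₀ h2 hm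
    exact_mod_cast this
  have hlow : (-1 : ℝ) < m := by
    rw [← hm']
    linarith [logWeight_nonneg μ t₁, logWeight_nonneg μ t₂, logWeight_lt_one μ (t₁ * t₂)]
  have hm0 : 0 ≤ m := by
    have : (-1 : ℤ) < m := by exact_mod_cast hlow
    omega
  obtain ⟨k, rfl⟩ := Int.eq_ofNat_of_zero_le hm0
  rw [twistExponent, hm']
  simp

end LogWeight

namespace FixedSet

variable {T : Type v} {M : Type u} [CommGroup T] [TopologicalSpace T] [TopologicalSpace M]
  [MulAction T M]

/-- The restriction of an equivariant bundle to `M^T`. -/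
def restrictBundle (E : TBundle T M) : TBundle T (FixedSet T M) :=
  E.pullback (fun x => x.1) continuous_val fun _ _ => rfl

/-- The restriction of an equivariant bundle to a component `W` of `M^T`. -/
def Component.restrictBundle (E : TBundle T (FixedSet T M))
    (W : ConnectedComponents (FixedSet T M)) : TBundle T (Component W) :=
  E.pullback (fun x => x.1) continuous_subtype_val fun _ _ => rfl

/-- The restriction `K_T(M^T) → K_T(W)`. -/
def Component.restrict (W : ConnectedComponents (FixedSet T M)) :
    KT T (FixedSet T M) →+* KT T (Component W) :=
  KT.pullback (fun x => x.1) continuous_subtype_val fun _ _ => rfl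

end FixedSet

/-- The abelian group `K_T(X) ⊗ ℤ[T]`. -/
abbrev StarModule (T : Type v) (X : Type u) [CommGroup T] [TopologicalSpace T] [TopologicalSpace X]
    [MulAction T X] :=
  KT T X ⊗[ℤ] MonoidAlgebra ℤ T

/-- The element `σ ⊗ t` of `K_T(X) ⊗ ℤ[T]`. -/
def pureTensor {T : Type v} {X : Type u} [CommGroup T] [TopologicalSpace T] [TopologicalSpace X]
    [MulAction T X] (σ : KT T X) (t : T) : StarModule T X :=
  σ ⊗ₜ[ℤ] MonoidAlgebra.of ℤ T t

namespace StableComplexStructure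

open FixedSet

variable {n : ℕ} {T : Type v} {M : Type u} [CommGroup T] [TopologicalSpace T] [CompactSpace T]
  [TopologicalSpace M] [ChartedSpace (EuclideanSpace ℝ (Fin n)) M] [IsManifold (𝓡 n) ∞ M]
  [MulAction T M] (S : StableComplexStructure n T M)
  (d : ℕ) [ChartedSpace (EuclideanSpace ℝ (Fin d)) T] [LieGroup (𝓡 d) ∞ T]
  [ContMDiffSMul (𝓡 d) (𝓡 n) ∞ T M]

/-- The normal bundle `ν(W, M)` of a component `W` of `M^T`, as a `T`-equivariant complex vector
bundle: the quotient of `TM ⊕ τ` restricted to `W` by `TW ⊕ τ`. Here the tangent space `T_p W` is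
the subspace of fixed vectors of `T_p M`, so that `T_p W ⊕ τ_p` is the complex subspace of fixed
vectors of `T_p M ⊕ τ_p`. -/
def normalBundle (W : ConnectedComponents (FixedSet T M)) : TBundle T (Component W) :=
  haveI : IsTopologicalGroup T := topologicalGroup_of_lieGroup (𝓡 d) ∞
  (Component.restrictBundle (restrictBundle (S.stableTangent d)) W).modFixed Component.smul_eq

/-- The isotypic component `I_μ` of the normal bundle `ν(W, M)`. -/
def normalIsotypic (W : ConnectedComponents (FixedSet T M)) (μ : T →ₜ* Circle) :
    TBundle T (Component W) :=
  haveI : IsTopologicalGroup T := topologicalGroup_of_lieGroup (𝓡 d) ∞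
  (S.normalBundle d W).isotypic Component.smul_eq μ

/-- The weights `μ` that occur in the normal bundle `ν(W, M)`. -/
def normalWeights (W : ConnectedComponents (FixedSet T M)) : Set (T →ₜ* Circle) :=
  {μ | ∃ p : Component W, Nontrivial ((S.normalIsotypic d W μ).fib p)}

/-- The product of the classes `ε(I_μ)^(a_μ(t₁) + a_μ(t₂) - a_μ(t₁ t₂))` over the isotypic
components `I_μ` of the normal bundle `ν(W, M)`. -/
def twistClass (W : ConnectedComponents (FixedSet T M)) (t₁ t₂ : T) : KT T (Component W) :=
  haveI : IsTopologicalGroup T := topologicalGroup_of_lieGroup (𝓡 d) ∞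
  ∏ᶠ μ ∈ S.normalWeights d W, KT.euler (S.normalIsotypic d W μ) ^ twistExponent μ t₁ t₂

/-- A biadditive product on `K_T(M^T) ⊗ ℤ[T]` is the star product if, on each component `W` of
`M^T`, the restriction of `(σ₁ ⊗ t₁) ⋆ (σ₂ ⊗ t₂)` is
`[σ₁|_W σ₂|_W ∏ ε(I_μ)^(a_μ(t₁) + a_μ(t₂) - a_μ(t₁ t₂))] ⊗ t₁ t₂`, the product being over the
isotypic components `I_μ` of `ν(W, M)`. -/
def IsStarProduct (star : StarModule T (FixedSet T M) →ₗ[ℤ] StarModule T (FixedSet T M) →ₗ[ℤ]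
    StarModule T (FixedSet T M)) : Prop :=
  ∀ (W : ConnectedComponents (FixedSet T M)) (σ₁ σ₂ : KT T (FixedSet T M)) (t₁ t₂ : T),
    (Component.restrict W).toIntAlgHom.toLinearMap.rTensor (MonoidAlgebra ℤ T)
      (star (pureTensor σ₁ t₁) (pureTensor σ₂ t₂)) =
    pureTensor (Component.restrict W σ₁ * Component.restrict W σ₂ * S.twistClass d W t₁ t₂)
      (t₁ * t₂)

end StableComplexStructure

end

end EquivK

/-! Since $M^T$ has finitely many components, each of them is open, and $M^T$ is topologically their
disjoint union. Equivariant bundles on the components therefore glue to a bundle on $M^T$, and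
isomorphisms glue as well, so that $K_T(M^T)\cong\prod_W K_T(W)$ (`restrictEquiv`). The classes
$\prod\epsilon(I_\mu)^{a_\mu(s)+a_\mu(t)-a_\mu(st)}$ on the components thus come from one class
$c(s,t)\in K_T(M^T)$ (`twist`), and $(\sigma\otimes s)\star(\tau\otimes t)=\sigma\tau\,c(s,t)\otimes
st$ has the prescribed restrictions. No other product does: an element of
$K_T(M^T)\otimes\mathbb{Z}[T]$ is determined by its restrictions to the components
(`starModule_ext`), and the elements $\sigma\otimes t$ generate this group additively
(`linearMap₂_ext`). Existence and uniqueness together are `isStarProduct_iff`.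

What remains is algebra of a group ring over a commutative ring $K$, twisted by a function
$c:T\times T\to K$. The product is commutative if $c$ is symmetric, unital if $c(1,t)=1$ as well,
and associative if $c(r,s)\,c(rs,t)=c(s,t)\,c(r,st)$; it is bilinear over any ring of which $K$ is
an algebra. The exponents $a_\mu(s)+a_\mu(t)-a_\mu(st)$ form a coboundary with real coefficients,
hence satisfy the additive cocycle identity (`twistExponent_cocycle`), and exponentiating gives the
identity for $c$ (`twistClass_cocycle`). No property of the Euler classes enters here: any family of
classes indexed by the weights would do.

Multiplying two products over the weights factor by factor requires that only finitely many weights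
occur on $W$. The fibres of each isotypic bundle have constant rank on the connected space $W$, so a
weight that occurs anywhere on $W$ occurs at a chosen point; nonzero vectors of distinct weights at
that point are linearly independent, by independence of characters, in a fibre of finite dimension
(`finite_setOf_nontrivial_isotypic`). -/

namespace EquivK

noncomputable section

open Module

universe u v w

/-! ### Local criteria for continuity of families of linear maps -/

section LocalContinuity

variable {X : Type*} {Y : Type*} {Z : Type*} [TopologicalSpace X] [TopologicalSpace Y]
  [TopologicalSpace Z]

/-- Continuity of a family of linear maps may be checked on an open cover of the parameter
space. -/
theorem IsContFam.of_openCover {E : VBundle X} {F : VBundle Y} {a : Z → X} {b : Z → Y}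
    {φ : ∀ z, E.fib (a z) →ₗ[ℂ] F.fib (b z)} {ι : Type*} {U : ι → Type*}
    [∀ i, TopologicalSpace (U i)] (g : ∀ i, U i → Z) (hg : ∀ i, Topology.IsOpenEmbedding (g i))
    (hcover : ∀ z, ∃ i u, g i u = z)
    (h : ∀ i, IsContFam E F (a ∘ g i) (b ∘ g i) fun u => φ (g i u)) :
    IsContFam E F a b φ := by
  intro x₀ y₁ j k
  refine continuous_iff_continuousAt.2 ?_
  rintro ⟨z, hz⟩
  obtain ⟨i, u, rfl⟩ := hcover z
  -- The matrix entry is defined only on a subset of `Z`, which need not be open because `a` and `b`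
  -- are arbitrary maps. An open embedding still restricts to an open embedding from the preimage of
  -- any subset onto its image there, and continuity at a point can be tested through it.
  have hr := Set.restrictPreimage_isOpenEmbedding
    {z : Z | a z ∈ E.nhd x₀ ∧ b z ∈ F.nhd y₁} (hg i)
  exact (hr.continuousAt_iff (x := ⟨u, hz⟩)).1 (h i x₀ y₁ j k).continuousAt

/-- The fibre of the pullback at `y` is by definition the fibre at `f y`, and its frames are those
of `E`, so the entries are transition functions of `E`. Together with `ofPullback` this moves
continuity statements between $M^T$ and its components. -/
theorem IsContFam.toPullback (E : VBundle X) {f : Y → X} (hf : Continuous f) :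
    IsContFam E (E.pullback f hf) f id fun _ => LinearMap.id :=
  fun x₀ y₁ j i => (isContFam_id E).param hf x₀ (f y₁) j i

theorem IsContFam.ofPullback (E : VBundle X) {f : Y → X} (hf : Continuous f) :
    IsContFam (E.pullback f hf) E id f fun _ => LinearMap.id :=
  fun y₀ x₁ j i => (isContFam_id E).param hf (f y₀) x₁ j i

end LocalContinuity

/-- The complement is the union of the other components, which are closed and finite in number. This
is the source of every use of the finiteness of the set of components in the gluing argument. -/
theorem isOpen_fiber_connectedComponents {X : Type*} [TopologicalSpace X]
    [Finite (ConnectedComponents X)] (W : ConnectedComponents X) :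
    IsOpen {x : X | ConnectedComponents.mk x = W} := by
  have h : {x : X | ConnectedComponents.mk x = W}ᶜ =
      ⋃ V ∈ {V : ConnectedComponents X | V ≠ W}, {x : X | ConnectedComponents.mk x = V} := by
    ext x
    simp
  rw [← isClosed_compl_iff, h]
  refine (Set.toFinite _).isClosed_biUnion fun V _ => ?_
  obtain ⟨x, rfl⟩ := ConnectedComponents.surjective_coe V
  have hx : {y : X | ConnectedComponents.mk y = ConnectedComponents.mk x} =
      connectedComponent x := by
    rw [← connectedComponents_preimage_singleton]
    rfl
  rw [hx]
  exact isClosed_connectedComponent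

/-! ### The components of the fixed point set -/

namespace FixedSet

variable {T : Type v} {M : Type u} [CommGroup T] [TopologicalSpace M] [MulAction T M]

theorem Component.isOpenEmbedding_val [Finite (ConnectedComponents (FixedSet T M))]
    (W : ConnectedComponents (FixedSet T M)) :
    Topology.IsOpenEmbedding fun x : Component W => x.1 :=
  (isOpen_fiber_connectedComponents W).isOpenEmbedding_subtypeVal

theorem Component.continuous_val (W : ConnectedComponents (FixedSet T M)) :
    Continuous fun x : Component W => x.1 :=
  continuous_subtype_val

/-- A fibre of the quotient map to the space of components is the connected component of any of its
points. Connectedness is what makes ranks of bundles constant on `W`. -/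
instance (W : ConnectedComponents (FixedSet T M)) : ConnectedSpace (Component W) := by
  obtain ⟨x, rfl⟩ := ConnectedComponents.surjective_coe W
  suffices h : IsConnected {y : FixedSet T M | ConnectedComponents.mk y = ConnectedComponents.mk x}
    from isConnected_iff_connectedSpace.1 h
  have hx : {y : FixedSet T M | ConnectedComponents.mk y = ConnectedComponents.mk x} =
      connectedComponent x := by
    rw [← connectedComponents_preimage_singleton]
    rfl
  rw [hx]
  exact isConnected_connectedComponent

variable [TopologicalSpace T]

/-- Bundles on `M^T` whose restrictions to all components are isomorphic are isomorphic. -/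
def isoOfComponents [Finite (ConnectedComponents (FixedSet T M))]
    {E F : TBundle T (FixedSet T M)}
    (e : ∀ W, TBundle.Iso (Component.restrictBundle E W) (Component.restrictBundle F W)) :
    TBundle.Iso E F where
  toEquiv x := (e (ConnectedComponents.mk x)).toEquiv ⟨x, rfl⟩
  equivariant t x y h v := by
    obtain rfl : x = y := (smul_eq t x).symm.trans h
    exact (e (ConnectedComponents.mk x)).equivariant t ⟨x, rfl⟩ ⟨x, rfl⟩
      (Component.smul_eq t _) v
  continuous_toEquiv := by
    refine IsContFam.of_openCover (fun W (x : Component W) => x.1)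
      Component.isOpenEmbedding_val (fun x => ⟨_, ⟨x, rfl⟩, rfl⟩) fun W => ?_
    have h := (IsContFam.ofPullback F.toVBundle (Component.continuous_val W)).comp
      ((e W).continuous_toEquiv.comp
        (IsContFam.toPullback E.toVBundle (Component.continuous_val W)) continuous_id)
      continuous_id
    -- On `W` the glued map is the given isomorphism over `W`, composed with the identities
    -- comparing a bundle and its pullback. Once `W` is replaced by the class of `x`, the two agree
    -- by definition.
    refine IsContFam.congr (a := fun x : Component W => x.1) (b := fun x => x.1) h ?_
    rintro ⟨x, rfl⟩
    rfl
  continuous_symm := by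
    refine IsContFam.of_openCover (fun W (x : Component W) => x.1)
      Component.isOpenEmbedding_val (fun x => ⟨_, ⟨x, rfl⟩, rfl⟩) fun W => ?_
    have h := (IsContFam.ofPullback E.toVBundle (Component.continuous_val W)).comp
      ((e W).continuous_symm.comp
        (IsContFam.toPullback F.toVBundle (Component.continuous_val W)) continuous_id)
      continuous_id
    refine IsContFam.congr (a := fun x : Component W => x.1) (b := fun x => x.1) h ?_
    rintro ⟨x, rfl⟩
    rfl

/-- A point of a component. -/
abbrev Component.point {W : ConnectedComponents (FixedSet T M)} (x : FixedSet T M)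
    (h : ConnectedComponents.mk x = W) : Component W :=
  ⟨x, h⟩

/-! ### Gluing equivariant bundles given on the components -/

section Glue

variable (E : ∀ W : ConnectedComponents (FixedSet T M), TBundle T (Component W))

/-- The identification of the fibre at `x` of the bundle over the component of `x` with the fibre
at `x` of the bundle over a component `W` containing `x`. -/
def fibEquiv (W : ConnectedComponents (FixedSet T M)) (x : FixedSet T M)
    (h : ConnectedComponents.mk x = W) :
    (E (ConnectedComponents.mk x)).fib (.point x rfl) ≃ₗ[ℂ] (E W).fib (.point x h) :=
  -- The two fibres have different types until `W` is identified with the class of `x`; after that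
  -- the map is the identity.
  match W, h with
  | _, rfl => LinearEquiv.refl ℂ _

/-- If the components differ, the two neighbourhoods are disjoint and there is nothing to check. If
they coincide, the identifications of fibres cancel and the entry is a transition function of the
bundle over that component. Keeping `W₀` and `W₁` as variables, instead of classes of points, allows
their equality to be substituted. -/
theorem continuous_glue_transition (W₀ W₁ : ConnectedComponents (FixedSet T M))
    (y₀ : Component W₀) (y₁ : Component W₁) (j i) :
    Continuous fun z : {z : FixedSet T M // (∃ h, Component.point z h ∈ (E W₀).nhd y₀) ∧
        ∃ h, Component.point z h ∈ (E W₁).nhd y₁} =>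
      ((E W₁).frame y₁ (.point z.1 z.2.2.1) z.2.2.2).repr (fibEquiv E W₁ z.1 z.2.2.1
        ((fibEquiv E W₀ z.1 z.2.1.1).symm
          ((E W₀).frame y₀ (.point z.1 z.2.1.1) z.2.1.2 j))) i := by
  by_cases hW : W₀ = W₁
  · subst hW
    refine ((E W₀).continuous_transition y₀ y₁ j i).comp
      (f := fun z : {z : FixedSet T M // (∃ h, Component.point z h ∈ (E W₀).nhd y₀) ∧
        ∃ h, Component.point z h ∈ (E W₀).nhd y₁} => (⟨.point z.1 z.2.1.1, z.2.1.2, z.2.2.2⟩ :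
          {p : Component W₀ // p ∈ (E W₀).nhd y₀ ∧ p ∈ (E W₀).nhd y₁}))
      ((continuous_subtype_val.subtype_mk _).subtype_mk _) |>.congr fun z => ?_
    rw [LinearEquiv.apply_symm_apply]
    rfl
  · refine continuous_iff_continuousAt.2 fun z => ?_
    obtain ⟨z, ⟨h₀, -⟩, h₁, -⟩ := z
    exact absurd (h₀.symm.trans h₁) hW

variable [Finite (ConnectedComponents (FixedSet T M))]

/-- The vector bundle on `M^T` given by vector bundles on its components. -/
def glueVBundle : VBundle (FixedSet T M) where
  fib x := (E (ConnectedComponents.mk x)).fib (.point x rfl)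
  nhd x := {y | ∃ h, Component.point y h ∈ (E (ConnectedComponents.mk x)).nhd (.point x rfl)}
  isOpen_nhd x := by
    have h : {y | ∃ h, Component.point y h ∈ (E (ConnectedComponents.mk x)).nhd (.point x rfl)} =
        (fun y : Component (ConnectedComponents.mk x) => y.1) ''
          (E (ConnectedComponents.mk x)).nhd (.point x rfl) := by
      ext y
      exact ⟨fun ⟨h, hy⟩ => ⟨⟨y, h⟩, hy, rfl⟩, fun ⟨⟨z, h⟩, hz, e⟩ => by
        obtain rfl : z = y := e
        exact ⟨h, hz⟩⟩
    rw [h]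
    exact (Component.isOpenEmbedding_val _).isOpenMap _
      ((E (ConnectedComponents.mk x)).isOpen_nhd _)
  mem_nhd x := ⟨rfl, (E (ConnectedComponents.mk x)).mem_nhd _⟩
  idx x := (E (ConnectedComponents.mk x)).idx (.point x rfl)
  frame x₀ x h := ((E (ConnectedComponents.mk x₀)).frame (.point x₀ rfl) (.point x h.1) h.2).map
    (fibEquiv E (ConnectedComponents.mk x₀) x h.1).symm
  continuous_transition x₀ x₁ j i :=
    continuous_glue_transition E (ConnectedComponents.mk x₀) (ConnectedComponents.mk x₁)
      (.point x₀ rfl) (.point x₁ rfl) j i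

/-- The frames of the glued bundle are transported frames of the given bundles, so the matrix
entries of the identification are again the functions of `continuous_glue_transition`. -/
theorem continuous_glue_fibEquiv (W : ConnectedComponents (FixedSet T M)) :
    IsContFam (glueVBundle E) (E W).toVBundle (fun x : Component W => x.1) id
      fun x => (fibEquiv E W x.1 x.2).toLinearMap := fun x₀ y₁ j i =>
  (continuous_glue_transition E (ConnectedComponents.mk x₀) W (.point x₀ rfl) y₁ j i).comp
    (f := fun z : {z : Component W // z.1 ∈ (glueVBundle E).nhd x₀ ∧ z ∈ (E W).nhd y₁} =>
      (⟨z.1.1, z.2.1, z.1.2, z.2.2⟩ : {z : FixedSet T M //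
        (∃ h, Component.point z h ∈ (E (ConnectedComponents.mk x₀)).nhd (.point x₀ rfl)) ∧
          ∃ h, Component.point z h ∈ (E W).nhd y₁}))
    (((Component.continuous_val W).comp continuous_subtype_val).subtype_mk _)

theorem continuous_glue_fibEquiv_symm (W : ConnectedComponents (FixedSet T M)) :
    IsContFam (E W).toVBundle (glueVBundle E) id (fun x : Component W => x.1)
      fun x => (fibEquiv E W x.1 x.2).symm.toLinearMap := fun y₀ x₁ j i =>
  (continuous_glue_transition E W (ConnectedComponents.mk x₁) y₀ (.point x₁ rfl) j i).comp
    (f := fun z : {z : Component W // z ∈ (E W).nhd y₀ ∧ z.1 ∈ (glueVBundle E).nhd x₁} =>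
      (⟨z.1.1, ⟨z.1.2, z.2.1⟩, z.2.2⟩ : {z : FixedSet T M //
        (∃ h, Component.point z h ∈ (E W).nhd y₀) ∧
          ∃ h, Component.point z h ∈ (E (ConnectedComponents.mk x₁)).nhd (.point x₁ rfl)}))
    (((Component.continuous_val W).comp continuous_subtype_val).subtype_mk _)

/-- The action on the fibres of `glueVBundle E`. -/
def glueAct (t : T) {x y : FixedSet T M} (h : t • x = y) :
    (glueVBundle E).fib x →ₗ[ℂ] (glueVBundle E).fib y :=
  -- The points of $M^T$ are fixed, so `y` is `x` and the action never leaves the fibre of one of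
  -- the given bundles.
  match y, (smul_eq t x).symm.trans h with
  | _, rfl => (E (ConnectedComponents.mk x)).act t (Component.smul_eq t (.point x rfl))

/-- Over a fixed component the action is conjugate to that of `E W`. In this form its continuity
follows from that of the identifications and of the action on `E W`. -/
theorem glueAct_eq (t : T) {W : ConnectedComponents (FixedSet T M)} (x : Component W)
    {y : FixedSet T M} (h : t • x.1 = y) (hy : ConnectedComponents.mk y = W) :
    glueAct E t h = (fibEquiv E W y hy).symm.toLinearMap ∘ₗ
      (E W).act t (x := x) (y := .point y hy) (Subtype.ext h) ∘ₗ
        (fibEquiv E W x.1 x.2).toLinearMap := by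
  obtain ⟨x, rfl⟩ := x
  obtain rfl : x = y := (smul_eq t x).symm.trans h
  rfl

/-- The equivariant bundle on `M^T` given by equivariant bundles on its components. -/
def glue : TBundle T (FixedSet T M) where
  toVBundle := glueVBundle E
  act t _ _ h := glueAct E t h
  act_one x h v := (E (ConnectedComponents.mk x)).act_one (.point x rfl) (Component.smul_eq 1 _) v
  act_mul s t x y z h₁ h₂ h₃ v := by
    obtain rfl : x = y := (smul_eq t x).symm.trans h₁
    obtain rfl : x = z := (smul_eq s x).symm.trans h₂
    exact (E (ConnectedComponents.mk x)).act_mul s t (.point x rfl) (.point x rfl) (.point x rfl)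
      (Component.smul_eq t _) (Component.smul_eq s _) (Component.smul_eq (s * t) _) v
  continuous_act := by
    -- The products of $T$ with the components form an open cover of $T\times M^T$.
    refine IsContFam.of_openCover
      (fun W (p : T × Component W) => ((p.1, p.2.1) : T × FixedSet T M))
      (fun W => Topology.IsOpenEmbedding.id.prodMap (Component.isOpenEmbedding_val W))
      (fun p => ⟨_, (p.1, ⟨p.2, rfl⟩), rfl⟩) fun W => ?_
    have hsm : Continuous fun p : T × Component W => p.1 • p.2 := continuous_smul
    have h₁ := (continuous_glue_fibEquiv E W).param (continuous_snd (X := T))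
    have h₂ := (E W).continuous_act.comp h₁ continuous_snd
    have h₃ := (continuous_glue_fibEquiv_symm E W).param hsm
    refine IsContFam.congr (h₃.comp h₂ hsm) fun p => ?_
    exact (glueAct_eq E p.1 p.2 rfl (p.1 • p.2).2).symm

/-- The restriction of a glued bundle to a component. -/
def glueRestrict (W : ConnectedComponents (FixedSet T M)) :
    TBundle.Iso (Component.restrictBundle (glue E) W) (E W) where
  toEquiv x := fibEquiv E W x.1 x.2
  equivariant t x y h v := by
    obtain ⟨x, rfl⟩ := x
    obtain rfl : (Component.point x rfl) = y := (Component.smul_eq t _).symm.trans h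
    rfl
  continuous_toEquiv := by
    have h := (continuous_glue_fibEquiv E W).comp
      (IsContFam.ofPullback (glueVBundle E) (Component.continuous_val W))
      (Component.continuous_val W)
    exact h
  continuous_symm := by
    have h := (IsContFam.toPullback (glueVBundle E) (Component.continuous_val W)).comp
      (continuous_glue_fibEquiv_symm E W) (Component.continuous_val W)
    exact h

end Glue

end FixedSet

/-! ### `K_T(M^T)` as a product over components -/

section KTheory

variable {T : Type v} {X : Type u} [Group T] [TopologicalSpace T] [TopologicalSpace X]
  [MulAction T X]

theorem KT.of_sum (E F : TBundle T X) : KT.of (E.sum F) = KT.of E + KT.of F :=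
  map_add (Algebra.GrothendieckAddGroup.of (M := Vect T X)) (show Vect T X from Quotient.mk _ E)
    (show Vect T X from Quotient.mk _ F)

theorem KT.of_eq_of_iso {E F : TBundle T X} (e : TBundle.Iso E F) : KT.of E = KT.of F :=
  congrArg (Algebra.GrothendieckAddGroup.of (M := Vect T X))
    (Quotient.sound (s := TBundle.setoid T X) ⟨e⟩)

theorem KT.exists_of_sub (x : KT T X) : ∃ E F : TBundle T X, x = KT.of E - KT.of F := by
  obtain ⟨a, b, h⟩ := GrothendieckAddGroup.exists_sub (M := Vect T X) x
  obtain ⟨E, rfl⟩ := Quotient.exists_rep a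
  obtain ⟨F, rfl⟩ := Quotient.exists_rep b
  exact ⟨E, F, h⟩

/-- Two elements of a commutative monoid become equal in its Grothendieck group exactly when they
agree after adding some common element. On classes of bundles this is stable isomorphism, with an
arbitrary equivariant bundle `G` as stabiliser. -/
theorem KT.exists_iso_of_of_eq {E F : TBundle T X} (h : KT.of E = KT.of F) :
    ∃ G : TBundle T X, Nonempty (TBundle.Iso (G.sum E) (G.sum F)) := by
  obtain ⟨⟨c, _⟩, hG⟩ :=
    (AddLocalization.addMonoidOf (⊤ : AddSubmonoid (Vect T X))).eq_iff_exists.1 h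
  obtain ⟨G, rfl⟩ := Quotient.exists_rep c
  exact ⟨G, Quotient.exact hG⟩

theorem KT.pullback_of {Y : Type w} [TopologicalSpace Y] [MulAction T Y] (f : Y → X)
    (hf : Continuous f) (hf' : ∀ (t : T) y, f (t • y) = t • f y) (E : TBundle T X) :
    KT.pullback f hf hf' (KT.of E) = KT.of (E.pullback f hf hf') :=
  GrothendieckAddGroup.lift_of _ _

end KTheory

namespace FixedSet

variable {T : Type v} {M : Type u} [CommGroup T] [TopologicalSpace T] [TopologicalSpace M]
  [MulAction T M]

theorem Component.restrict_of (W : ConnectedComponents (FixedSet T M))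
    (E : TBundle T (FixedSet T M)) :
    Component.restrict W (KT.of E) = KT.of (Component.restrictBundle E W) :=
  KT.pullback_of _ _ _ E

variable [Finite (ConnectedComponents (FixedSet T M))]

/-- If $[E]-[F]$ restricts to zero on every component, then $E$ and $F$ become isomorphic over each
$W$ after adding a bundle $G_W$. The $G_W$ may be unrelated to each other, but they glue to one
bundle $G$ on $M^T$; the isomorphisms glue too, giving $G\oplus E\cong G\oplus F$. -/
theorem restrict_injective :
    Function.Injective (RingHom.pi (Component.restrict (T := T) (M := M))) := by
  refine (injective_iff_map_eq_zero _).2 fun x hx => ?_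
  obtain ⟨E, F, rfl⟩ := KT.exists_of_sub x
  have h : ∀ W, ∃ G : TBundle T (Component W), Nonempty (TBundle.Iso
      (G.sum (Component.restrictBundle E W)) (G.sum (Component.restrictBundle F W))) := by
    intro W
    refine KT.exists_iso_of_of_eq ?_
    have := congrFun hx W
    rwa [RingHom.pi_apply, map_sub, Component.restrict_of, Component.restrict_of, Pi.zero_apply,
      sub_eq_zero] at this
  choose G hG using h
  have e : ∀ W, TBundle.Iso (Component.restrictBundle ((glue G).sum E) W)
      (Component.restrictBundle ((glue G).sum F) W) := fun W =>
    ((glueRestrict G W).sumCongr (TBundle.Iso.refl _)).trans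
      ((hG W).some.trans ((glueRestrict G W).symm.sumCongr (TBundle.Iso.refl _)))
  have := KT.of_eq_of_iso (isoOfComponents e)
  rw [KT.of_sum, KT.of_sum, add_right_inj] at this
  rw [this, sub_self]

/-- The classes on the components are differences of bundles, and minuends and subtrahends are glued
separately. -/
theorem restrict_surjective :
    Function.Surjective (RingHom.pi (Component.restrict (T := T) (M := M))) := by
  intro y
  choose E F h using fun W => KT.exists_of_sub (y W)
  refine ⟨KT.of (glue E) - KT.of (glue F), funext fun W => ?_⟩
  rw [RingHom.pi_apply, map_sub, Component.restrict_of, Component.restrict_of, h W,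
    KT.of_eq_of_iso (glueRestrict E W), KT.of_eq_of_iso (glueRestrict F W)]

/-- The isomorphism `K_T(M^T) ≅ ∏_W K_T(W)`. -/
def restrictEquiv :
    KT T (FixedSet T M) ≃+* ∀ W : ConnectedComponents (FixedSet T M), KT T (Component W) :=
  RingEquiv.ofBijective (RingHom.pi Component.restrict) ⟨restrict_injective, restrict_surjective⟩

theorem restrict_restrictEquiv_symm
    (y : ∀ W : ConnectedComponents (FixedSet T M), KT T (Component W)) (W) :
    Component.restrict W (restrictEquiv.symm y) = y W :=
  congrFun (restrictEquiv.apply_symm_apply y) W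

end FixedSet

/-! ### Finiteness of the set of weights -/

theorem VBundle.finite_fib {X : Type*} [TopologicalSpace X] (E : VBundle X) (x : X) :
    Module.Finite ℂ (E.fib x) :=
  Module.Finite.of_basis (E.frame x x (E.mem_nhd x))

/-- Over `nhd x` all fibres have bases indexed by the same finite set. -/
theorem VBundle.isLocallyConstant_finrank {X : Type*} [TopologicalSpace X] (E : VBundle X) :
    IsLocallyConstant fun x => finrank ℂ (E.fib x) := by
  refine (IsLocallyConstant.iff_exists_open _).2 fun x => ?_
  refine ⟨E.nhd x, E.isOpen_nhd x, E.mem_nhd x, fun y hy => ?_⟩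
  exact (finrank_eq_nat_card_basis (E.frame x y hy)).trans
    (finrank_eq_nat_card_basis (E.frame x x (E.mem_nhd x))).symm

/-- Applied to isotypic bundles, this shows that a weight occurring at one point of a connected base
occurs at every point. It relies on the weight spaces forming a vector bundle. -/
theorem VBundle.nontrivial_fib {X : Type*} [TopologicalSpace X] [PreconnectedSpace X]
    (E : VBundle X) {x : X} (h : Nontrivial (E.fib x)) (y : X) : Nontrivial (E.fib y) := by
  have := E.finite_fib
  have e := E.isLocallyConstant_finrank.apply_eq_of_preconnectedSpace x y
  have hx : 0 < finrank ℂ (E.fib x) := finrank_pos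
  exact nontrivial_of_finrank_pos (R := ℂ) (e ▸ hx)

namespace TBundle

variable {T : Type v} {X : Type u} [Group T] [TopologicalSpace T] [TopologicalSpace X]
  [MulAction T X]

/-- Vectors of distinct weights are linearly independent. -/
theorem linearIndependent_of_mem_weightSpace (E : TBundle T X)
    (htriv : ∀ (t : T) (x : X), t • x = x) (x : X) {s : Set (T →ₜ* Circle)} (v : s → E.fib x)
    (hv : ∀ μ : s, v μ ∈ E.weightSpace htriv μ x) (hv₀ : ∀ μ, v μ ≠ 0) :
    LinearIndependent ℂ v := by
  -- Independence of characters: distinct continuous characters into the circle stay distinct as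
  -- monoid homomorphisms into $\mathbb{C}$, and such homomorphisms are linearly independent
  -- functions on $T$.
  have hchar : LinearIndependent ℂ fun (μ : s) (t : T) => ((μ.1 t : Circle) : ℂ) := by
    refine (linearIndependent_monoidHom T ℂ).comp
      (fun μ : s => Circle.coeHom.comp μ.1.toMonoidHom) fun μ ν h => ?_
    refine Subtype.ext (ContinuousMonoidHom.ext fun t => ?_)
    exact Circle.ext (DFunLike.congr_fun h t)
  rw [linearIndependent_iff'] at hchar ⊢
  intro I c hc μ hμ
  -- Acting with $t$ on $\sum_\nu c_\nu v_\nu=0$ and applying $\varphi$ gives $\sum_\nu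
  -- c_\nu\varphi(v_\nu)\,\nu(t)=0$ for all $t$, a relation among characters.
  have hφ : ∀ φ : Module.Dual ℂ (E.fib x), c μ * φ (v μ) = 0 := by
    intro φ
    refine hchar I (fun ν => c ν * φ (v ν)) (funext fun t => ?_) μ hμ
    have h := congrArg (fun w => φ (E.act t (htriv t x) w)) hc
    simp only [map_sum, map_smul, map_zero, smul_eq_mul] at h
    rw [Finset.sum_apply, Pi.zero_apply, ← h]
    refine Finset.sum_congr rfl fun ν _ => ?_
    rw [hv ν t, map_smul, Pi.smul_apply, smul_eq_mul, smul_eq_mul]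
    ring
  by_contra hcμ
  refine hv₀ μ ((Module.forall_dual_apply_eq_zero_iff ℂ (v μ)).1 fun φ => ?_)
  exact (mul_eq_zero.1 (hφ φ)).resolve_left hcμ

/-- Only finitely many weights occur in a bundle over a connected space. -/
theorem finite_setOf_nontrivial_isotypic [IsTopologicalGroup T] [CompactSpace T]
    [PreconnectedSpace X] (E : TBundle T X) (htriv : ∀ (t : T) (x : X), t • x = x) :
    {μ : T →ₜ* Circle | ∃ x, Nontrivial ((E.isotypic htriv μ).fib x)}.Finite := by
  rcases isEmpty_or_nonempty X with hX | ⟨⟨x⟩⟩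
  · refine Set.finite_empty.subset ?_
    rintro μ ⟨x, -⟩
    exact hX.elim x
  -- All the weights are compared at the single point `x`, whichever points they were found at.
  have h : ∀ μ : {μ : T →ₜ* Circle | ∃ x, Nontrivial ((E.isotypic htriv μ).fib x)},
      ∃ v : E.fib x, v ∈ E.weightSpace htriv μ x ∧ v ≠ 0 := by
    rintro ⟨μ, y, hy⟩
    have hx : Nontrivial (E.weightSpace htriv μ x) :=
      (E.isotypic htriv μ).toVBundle.nontrivial_fib hy x
    obtain ⟨v, hv⟩ := exists_ne (0 : E.weightSpace htriv μ x)
    exact ⟨v, v.2, fun h => hv (Subtype.ext h)⟩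
  choose v hv hv₀ using h
  have := E.finite_fib x
  exact (E.linearIndependent_of_mem_weightSpace htriv x v hv hv₀).finite

end TBundle

/-! ### The twisting cocycle -/

section TwistExponent

theorem logWeight_one {T : Type v} [Group T] [TopologicalSpace T] (μ : T →ₜ* Circle) :
    logWeight μ 1 = 0 := by
  simp [logWeight]

theorem twistExponent_one_left {T : Type v} [Group T] [TopologicalSpace T] (μ : T →ₜ* Circle)
    (t : T) : twistExponent μ 1 t = 0 := by
  simp [twistExponent, logWeight_one]

theorem twistExponent_comm {T : Type v} [CommGroup T] [TopologicalSpace T] (μ : T →ₜ* Circle)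
    (s t : T) : twistExponent μ s t = twistExponent μ t s := by
  simp [twistExponent, mul_comm s t, add_comm (logWeight μ s)]

/-- Both sides equal $a_\mu(r)+a_\mu(s)+a_\mu(t)-a_\mu(rst)$. The comparison takes place in
$\mathbb{R}$, where `twistExponent_eq` removes the floor. -/
theorem twistExponent_cocycle {T : Type v} [Group T] [TopologicalSpace T] (μ : T →ₜ* Circle)
    (r s t : T) : twistExponent μ r s + twistExponent μ (r * s) t =
      twistExponent μ s t + twistExponent μ r (s * t) := by
  have h : ((twistExponent μ r s + twistExponent μ (r * s) t : ℕ) : ℝ) =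
      (twistExponent μ s t + twistExponent μ r (s * t) : ℕ) := by
    push_cast
    simp only [twistExponent_eq, mul_assoc]
    ring
  exact_mod_cast h

end TwistExponent

/-! ### The twisting classes of the normal bundles -/

namespace StableComplexStructure

open FixedSet

variable {n : ℕ} {T : Type v} {M : Type u} [CommGroup T] [TopologicalSpace T] [CompactSpace T]
  [TopologicalSpace M] [ChartedSpace (EuclideanSpace ℝ (Fin n)) M] [IsManifold (𝓡 n) ∞ M]
  [MulAction T M] (S : StableComplexStructure n T M)
  (d : ℕ) [ChartedSpace (EuclideanSpace ℝ (Fin d)) T] [LieGroup (𝓡 d) ∞ T]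
  [ContMDiffSMul (𝓡 d) (𝓡 n) ∞ T M]

/-- This allows products of Euler classes over the weights to be multiplied factor by factor. -/
theorem finite_normalWeights (W : ConnectedComponents (FixedSet T M)) :
    (S.normalWeights d W).Finite :=
  haveI : IsTopologicalGroup T := topologicalGroup_of_lieGroup (𝓡 d) ∞
  (S.normalBundle d W).finite_setOf_nontrivial_isotypic Component.smul_eq

theorem twistClass_one_left (W : ConnectedComponents (FixedSet T M)) (t : T) :
    S.twistClass d W 1 t = 1 := by
  simp [twistClass, twistExponent_one_left]

theorem twistClass_comm (W : ConnectedComponents (FixedSet T M)) (s t : T) :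
    S.twistClass d W s t = S.twistClass d W t s := by
  simp only [twistClass, twistExponent_comm _ s t]

/-- The exponents of each $\epsilon(I_\mu)$ add up to the same number on both sides. Only powers in
a commutative ring are involved, so the Euler classes need not be invertible or nonzero. -/
theorem twistClass_cocycle (W : ConnectedComponents (FixedSet T M)) (r s t : T) :
    S.twistClass d W r s * S.twistClass d W (r * s) t =
      S.twistClass d W s t * S.twistClass d W r (s * t) := by
  have hfin := S.finite_normalWeights d W
  simp only [twistClass]
  rw [← finprod_mem_mul_distrib hfin, ← finprod_mem_mul_distrib hfin]
  simp only [← pow_add, twistExponent_cocycle]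

end StableComplexStructure

/-! ### Twisted group rings -/

section TwistedProduct

variable {K : Type*} [CommRing K] {T : Type*} [CommGroup T]

/-- A linear map on `K ⊗ ℤ[T]` is given by a family of linear maps on `K` indexed by `T`. -/
def liftTensorMonoidAlgebra (K T Q : Type*) [CommRing K] [CommGroup T] [AddCommGroup Q] :
    (T → K →ₗ[ℤ] Q) →ₗ[ℤ] (K ⊗[ℤ] MonoidAlgebra ℤ T →ₗ[ℤ] Q) :=
  -- Read from right to left: a family on the basis `T` extends to a linear map from $\mathbb{Z}[T]$
  -- to $\mathrm{Hom}(K,Q)$, its two arguments are exchanged, and the resulting bilinear map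
  -- descends to the tensor product.
  (TensorProduct.lift.equiv (RingHom.id ℤ) K (MonoidAlgebra ℤ T) Q).toLinearMap ∘ₗ
    LinearMap.lflip.toLinearMap ∘ₗ ((MonoidAlgebra.basis T ℤ).constr ℤ).toLinearMap

theorem liftTensorMonoidAlgebra_tmul {Q : Type*} [AddCommGroup Q] (f : T → K →ₗ[ℤ] Q) (σ : K)
    (t : T) : liftTensorMonoidAlgebra K T Q f (σ ⊗ₜ MonoidAlgebra.of ℤ T t) = f t σ := by
  have h := (MonoidAlgebra.basis T ℤ).constr_basis ℤ f t
  exact LinearMap.congr_fun h σ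

/-- Elements of `K ⊗ ℤ[T]` are sums of elements `σ ⊗ t`. -/
theorem tensorMonoidAlgebra_induction {p : K ⊗[ℤ] MonoidAlgebra ℤ T → Prop}
    (tmul : ∀ σ t, p (σ ⊗ₜ MonoidAlgebra.of ℤ T t)) (add : ∀ x y, p x → p y → p (x + y))
    (x : K ⊗[ℤ] MonoidAlgebra ℤ T) : p x := by
  -- The zero element is itself of the form $\sigma\otimes t$, so it needs no case of its own.
  have zero : p 0 := by simpa using tmul 0 1
  induction x using TensorProduct.induction_on with
  | zero => exact zero
  | add x y hx hy => exact add x y hx hy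
  | tmul σ a =>
    induction a using MonoidAlgebra.induction_on generalizing σ with
    | of t => exact tmul σ t
    | add a b ha hb => rw [TensorProduct.tmul_add]; exact add _ _ (ha σ) (hb σ)
    | smul r a ha =>
      -- The integer coefficient moves into the factor $K$, which is why the induction is on all `σ`
      -- at once.
      rw [← TensorProduct.smul_tmul]
      exact ha (r • σ)

theorem linearMap₂_ext {Q : Type*} [AddCommGroup Q]
    {f g : K ⊗[ℤ] MonoidAlgebra ℤ T →ₗ[ℤ] K ⊗[ℤ] MonoidAlgebra ℤ T →ₗ[ℤ] Q}
    (h : ∀ σ τ s t, f (σ ⊗ₜ MonoidAlgebra.of ℤ T s) (τ ⊗ₜ MonoidAlgebra.of ℤ T t) =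
      g (σ ⊗ₜ MonoidAlgebra.of ℤ T s) (τ ⊗ₜ MonoidAlgebra.of ℤ T t)) : f = g := by
  refine LinearMap.ext fun x => LinearMap.ext fun y => ?_
  induction x using tensorMonoidAlgebra_induction with
  | add x x' hx hx' => rw [map_add, map_add, LinearMap.add_apply, LinearMap.add_apply, hx, hx']
  | tmul σ s =>
    induction y using tensorMonoidAlgebra_induction with
    | add y y' hy hy' => rw [map_add, map_add, hy, hy']
    | tmul τ t => exact h σ τ s t

/-- The product on `K ⊗ ℤ[T]` twisted by `c`. -/
def twistedProduct (c : T → T → K) : K ⊗[ℤ] MonoidAlgebra ℤ T →ₗ[ℤ]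
    K ⊗[ℤ] MonoidAlgebra ℤ T →ₗ[ℤ] K ⊗[ℤ] MonoidAlgebra ℤ T :=
  liftTensorMonoidAlgebra K T _ fun s => liftTensorMonoidAlgebra K T _ ∘ₗ LinearMap.pi fun t =>
    -- For fixed $s$ and $t$ this is the bilinear map $(\sigma,\tau)\mapsto\sigma\tau\,c(s,t)\otimes
    -- st$.
    (LinearMap.mul ℤ K).compr₂
      ((TensorProduct.mk ℤ K (MonoidAlgebra ℤ T)).flip (MonoidAlgebra.of ℤ T (s * t)) ∘ₗ
        LinearMap.mulRight ℤ (c s t))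

theorem twistedProduct_tmul (c : T → T → K) (σ τ : K) (s t : T) :
    twistedProduct c (σ ⊗ₜ MonoidAlgebra.of ℤ T s) (τ ⊗ₜ MonoidAlgebra.of ℤ T t) =
      (σ * τ * c s t) ⊗ₜ MonoidAlgebra.of ℤ T (s * t) := by
  rw [twistedProduct, liftTensorMonoidAlgebra_tmul, LinearMap.comp_apply,
    liftTensorMonoidAlgebra_tmul]
  rfl

variable {c : T → T → K}

theorem twistedProduct_comm (hc : ∀ s t, c s t = c t s) (x y : K ⊗[ℤ] MonoidAlgebra ℤ T) :
    twistedProduct c x y = twistedProduct c y x := by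
  induction x using tensorMonoidAlgebra_induction with
  | add x x' hx hx' => rw [map_add, LinearMap.add_apply, hx, hx', map_add]
  | tmul σ s =>
    induction y using tensorMonoidAlgebra_induction with
    | add y y' hy hy' => rw [map_add, hy, hy', map_add, LinearMap.add_apply]
    | tmul τ t => rw [twistedProduct_tmul, twistedProduct_tmul, hc, mul_comm σ, mul_comm s]

/-- On generators the two bracketings of $\rho\otimes r$, $\sigma\otimes s$, $\tau\otimes t$ have
coefficients $\rho\sigma\tau\,c(r,s)\,c(rs,t)$ and $\rho\sigma\tau\,c(s,t)\,c(r,st)$ at $rst$. -/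
theorem twistedProduct_assoc (hc : ∀ r s t, c r s * c (r * s) t = c s t * c r (s * t))
    (x y z : K ⊗[ℤ] MonoidAlgebra ℤ T) :
    twistedProduct c (twistedProduct c x y) z = twistedProduct c x (twistedProduct c y z) := by
  induction x using tensorMonoidAlgebra_induction with
  | add x x' hx hx' => simp only [map_add, LinearMap.add_apply, hx, hx']
  | tmul ρ r =>
    induction y using tensorMonoidAlgebra_induction with
    | add y y' hy hy' => simp only [map_add, LinearMap.add_apply, hy, hy']
    | tmul σ s =>
      induction z using tensorMonoidAlgebra_induction with
      | add z z' hz hz' => simp only [map_add, hz, hz']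
      | tmul τ t =>
        simp only [twistedProduct_tmul, mul_assoc r s t]
        congr 1
        linear_combination ρ * σ * τ * hc r s t

theorem twistedProduct_one_left (hc : ∀ t, c 1 t = 1) (x : K ⊗[ℤ] MonoidAlgebra ℤ T) :
    twistedProduct c (1 ⊗ₜ MonoidAlgebra.of ℤ T 1) x = x := by
  induction x using tensorMonoidAlgebra_induction with
  | add x y hx hy => rw [map_add, hx, hy]
  | tmul σ t => rw [twistedProduct_tmul, hc, one_mul, one_mul, mul_one]

/-- Scalars act through the factor $K$ alone, where the product is the ordinary one times $c$. This
gives linearity over $K_T(\mathrm{pt})$ for every twist. -/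
theorem twistedProduct_smul_left {R : Type*} [CommRing R] [Algebra R K] (r : R)
    (x y : K ⊗[ℤ] MonoidAlgebra ℤ T) :
    twistedProduct c (r • x) y = r • twistedProduct c x y := by
  induction x using tensorMonoidAlgebra_induction with
  | add x x' hx hx' => simp only [smul_add, map_add, LinearMap.add_apply, hx, hx']
  | tmul σ s =>
    induction y using tensorMonoidAlgebra_induction with
    | add y y' hy hy' => simp only [smul_add, map_add, hy, hy']
    | tmul τ t =>
      simp only [TensorProduct.smul_tmul', twistedProduct_tmul, smul_mul_assoc]

end TwistedProduct

/-! ### Existence and uniqueness of the star product -/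

namespace FixedSet

variable {T : Type v} {M : Type u} [CommGroup T] [TopologicalSpace T] [TopologicalSpace M]
  [MulAction T M]

theorem rTensor_restrict_pureTensor (W : ConnectedComponents (FixedSet T M))
    (σ : KT T (FixedSet T M)) (t : T) :
    (Component.restrict W).toIntAlgHom.toLinearMap.rTensor (MonoidAlgebra ℤ T) (pureTensor σ t) =
      pureTensor (Component.restrict W σ) t :=
  rfl

variable [Finite (ConnectedComponents (FixedSet T M))]

open Classical in
/-- Elements of `K_T(M^T) ⊗ ℤ[T]` are determined by their restrictions to the components. -/
theorem starModule_ext {x y : StarModule T (FixedSet T M)}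
    (h : ∀ W : ConnectedComponents (FixedSet T M),
      (Component.restrict W).toIntAlgHom.toLinearMap.rTensor (MonoidAlgebra ℤ T) x =
        (Component.restrict W).toIntAlgHom.toLinearMap.rTensor (MonoidAlgebra ℤ T) y) :
    x = y := by
  let _ := Fintype.ofFinite (ConnectedComponents (FixedSet T M))
  -- Extension by zero from `W` to the whole of $M^T$, available because $K_T(M^T)$ is the product
  -- over the components.
  let ext (W : ConnectedComponents (FixedSet T M)) :
      KT T (Component W) →ₗ[ℤ] KT T (FixedSet T M) :=
    (restrictEquiv (T := T) (M := M)).symm.toAddEquiv.toIntLinearEquiv.toLinearMap ∘ₗ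
      LinearMap.single ℤ (fun W : ConnectedComponents (FixedSet T M) => KT T (Component W)) W
  -- A finite decomposition of the identity of $K_T(M^T)$. It persists after tensoring with
  -- $\mathbb{Z}[T]$ and recovers an element from its restrictions.
  have hext : ∑ W, ext W ∘ₗ (Component.restrict W).toIntAlgHom.toLinearMap = LinearMap.id := by
    refine LinearMap.ext fun σ => restrictEquiv.injective ?_
    rw [LinearMap.sum_apply, map_sum]
    refine Eq.trans (Finset.sum_congr rfl fun W _ => restrictEquiv.apply_symm_apply _) ?_
    exact Finset.univ_sum_single (restrictEquiv σ)
  have key : ∀ z : StarModule T (FixedSet T M), z = ∑ W, (ext W).rTensor (MonoidAlgebra ℤ T)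
      ((Component.restrict W).toIntAlgHom.toLinearMap.rTensor (MonoidAlgebra ℤ T) z) := by
    intro z
    have := LinearMap.congr_fun (congrArg (LinearMap.rTensor (MonoidAlgebra ℤ T)) hext) z
    rw [LinearMap.rTensor_id, ← LinearMap.coe_rTensorHom, map_sum, LinearMap.sum_apply] at this
    simp only [LinearMap.coe_rTensorHom, LinearMap.rTensor_comp, LinearMap.comp_apply, LinearMap.id_apply] at this
    exact this.symm
  rw [key x, key y]
  exact Finset.sum_congr rfl fun W _ => congrArg _ (h W)

end FixedSet

namespace StableComplexStructure

open FixedSet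

variable {n : ℕ} {T : Type v} {M : Type u} [CommGroup T] [TopologicalSpace T] [CompactSpace T]
  [TopologicalSpace M] [ChartedSpace (EuclideanSpace ℝ (Fin n)) M] [IsManifold (𝓡 n) ∞ M]
  [MulAction T M] (S : StableComplexStructure n T M)
  (d : ℕ) [ChartedSpace (EuclideanSpace ℝ (Fin d)) T] [LieGroup (𝓡 d) ∞ T]
  [ContMDiffSMul (𝓡 d) (𝓡 n) ∞ T M] [Finite (ConnectedComponents (FixedSet T M))]

/-- The class on `M^T` whose restriction to each component is the twisting class. -/
def twist (s t : T) : KT T (FixedSet T M) :=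
  restrictEquiv.symm fun W => S.twistClass d W s t

theorem twist_one_left (t : T) : S.twist d 1 t = 1 := by
  simp only [twist, twistClass_one_left]
  exact map_one restrictEquiv.symm

theorem twist_comm (s t : T) : S.twist d s t = S.twist d t s := by
  simp only [twist, S.twistClass_comm d _ s t]

theorem twist_cocycle (r s t : T) :
    S.twist d r s * S.twist d (r * s) t = S.twist d s t * S.twist d r (s * t) := by
  simp only [twist, ← map_mul]
  exact congrArg _ (funext fun W => S.twistClass_cocycle d W r s t)

/-- The twisted product satisfies the defining formula since `twist` restricts to the twisting class
of each component. Any other solution has the same restrictions on products of generators, hence the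
same values there, and a bilinear map is determined by these. -/
theorem isStarProduct_iff (star : StarModule T (FixedSet T M) →ₗ[ℤ]
    StarModule T (FixedSet T M) →ₗ[ℤ] StarModule T (FixedSet T M)) :
    S.IsStarProduct d star ↔ star = twistedProduct (S.twist d) := by
  have htwist : ∀ W s t, Component.restrict W (S.twist d s t) = S.twistClass d W s t :=
    fun W s t => restrict_restrictEquiv_symm _ W
  have hex : S.IsStarProduct d (twistedProduct (S.twist d)) := by
    intro W σ τ s t
    refine (congrArg _ (twistedProduct_tmul _ σ τ s t)).trans ?_
    refine (rTensor_restrict_pureTensor W _ _).trans ?_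
    rw [map_mul, map_mul, htwist]
  refine ⟨fun h => linearMap₂_ext fun σ τ s t => ?_, fun h => h ▸ hex⟩
  exact starModule_ext fun W => (h W σ τ s t).trans (hex W σ τ s t).symm

end StableComplexStructure

end

end EquivK

theorem mainTheorem9 {d n : ℕ} {T : Type*} {M : Type*}
    [CommGroup T] [TopologicalSpace T] [T2Space T] [CompactSpace T] [ConnectedSpace T]
    [ChartedSpace (EuclideanSpace ℝ (Fin d)) T] [LieGroup (𝓡 d) ∞ T]
    [TopologicalSpace M] [T2Space M] [SecondCountableTopology M]
    [ChartedSpace (EuclideanSpace ℝ (Fin n)) M] [IsManifold (𝓡 n) ∞ M]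
    [MulAction T M] [ContMDiffSMul (𝓡 d) (𝓡 n) ∞ T M]
    (S : EquivK.StableComplexStructure n T M) [Finite (ConnectedComponents (EquivK.FixedSet T M))] :
    (∃! star, S.IsStarProduct d star) ∧
    ∀ star, S.IsStarProduct d star →
      (∀ x y, star x y = star y x) ∧
      (∀ x y z, star (star x y) z = star x (star y z)) ∧
      (∀ x, star (EquivK.pureTensor 1 1) x = x ∧ star x (EquivK.pureTensor 1 1) = x) ∧
      (∀ (r : EquivK.KT T PUnit.{1}) x y,
        star (r • x) y = r • star x y ∧ star x (r • y) = r • star x y) := by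
  -- The defining condition becomes equality with one explicit product, which settles existence and
  -- uniqueness; the algebra axioms then concern this product alone.
  simp only [S.isStarProduct_iff d]
  refine ⟨⟨_, rfl, fun _ h => h⟩, ?_⟩
  rintro star rfl
  have hcomm := EquivK.twistedProduct_comm (S.twist_comm d)
  have hone := EquivK.twistedProduct_one_left (S.twist_one_left d)
  refine ⟨hcomm, EquivK.twistedProduct_assoc (S.twist_cocycle d),
    fun x => ⟨hone x, (hcomm _ _).trans (hone x)⟩, fun r x y => ?_⟩
  have hsmul := EquivK.twistedProduct_smul_left (c := S.twist d) r
  exact ⟨hsmul x y, (hcomm x _).trans ((hsmul y x).trans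
    (congrArg (fun z : EquivK.StarModule T (EquivK.FixedSet T M) => r • z) (hcomm y x)))⟩
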